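/- Let $p\ge 1$. For a Banach space $X$: - A continuous $g:\mathbb R\to X$ is almost automorphic if every real sequence $(s'_n)$ has a subsequence $(s_n)$ and a function $\tilde g:\mathbb R\to X$ with $\lim_n g(t+s_n)=\tilde g(t)$ and $\lim_n\tilde g(t-s_n)=g(t)$ for all $t\in\mathbb R$. It is compact almost automorphic if, moreover, $(s_n)$ and $\tilde g$ can be chosen so that both limits are uniform on every compact subset of $\mathbb R$. - $\mathbb ZAA(\mathbb R;X)$ is the set of $g:\mathbb R\to X$ that are continuous on each $[n,n+1)$, $n\in\mathbb Z$, have a left limit at each integer, and are such that every sequence of integers $(s'_n)$ has a subsequence $(s_n)$ and a function $\tilde g:\mathbb R\to X$ with $\lim_n g(t+s_n)=\tilde g(t)$ and $\lim_n\tilde g(t-s_n)=g(t)$ for all $t\in\mathbb R$. - $G:\mathbb Z\times\mathbb Z\to X$ is Bi-almost automorphic if every sequence of integers $(s'_n)$ has a subsequence $(s_n)$ and a function $\tilde G$ with $\lim_n G(k+s_n,m+s_n)=\tilde G(k,m)$ and $\lim_n\tilde G(k-s_n,m-s_n)=G(k,m)$ for all $k,m\in\mathbb Z$. Let $A,B:\mathbb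 R\to\mathbb C^{p\times p}$ be almost automorphic and let $f\in\mathbb ZAA(\mathbb R;\mathbb C^p)$ be bounded. Let $\Phi(t)$ be a fundamental matrix solution of $y'=A(t)y$, put $\Phi(t,s)=\Phi(t)\Phi(s)^{-1}$ and $$C(n)=\Phi(n+1,n)+\int_n^{n+1}\Phi(n+1,u)B(u)\,du,\qquad n\in\mathbb Z.$$ Suppose that the system $y(n+1)=C(n)y(n)$, $n\in\mathbb Z$, has a Bi-almost automorphic exponential dichotomy with parameters $(\alpha,K,P)$; that is, $\alpha,K>0$, $P^2=P$, and there is an invertible fundamental matrix solution $Y(n)$ of the system whose Green function $$G(n,m)=\begin{cases}Y(n)PY(m)^{-1}, & n\ge m,\\ -Y(n)(I-P)Y(m)^{-1}, & n<m,\end{cases}$$ satisfies $\|G(n,m)\|\le Ke^{-\alpha|n-m|}$ for all $n,m\in\mathbb Z$ and is Bi-almost automorphic. Then the equation $$y'(t)=A(t)y(t)+B(t)y([t])+f(t)$$ ($[\cdot]$ is the integer part) has exactly one compact almost automorphic solution $y:\mathbb R\to\mathbb C^p$. Here a solution is a continuous function that satisfies the equation on each interval $(n,n+1)$, $n\in\mathbb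 Z$, and satisfies it at each $n\in\mathbb Z$ with the right-hand derivative. -/

import Mathlib

open Filter Topology Set MeasureTheory

-- Matrices carry the operator norm induced by the supremum norm on `Fin p → ℂ`.
attribute [local instance] Matrix.linftyOpNormedAddCommGroup Matrix.linftyOpNormedSpace

namespace DEPCA

section Functions

variable {X : Type*} [NormedAddCommGroup X]

/-- Almost automorphic functions on the real line. -/
def IsAlmostAutomorphic (f : ℝ → X) : Prop :=
  Continuous f ∧
    ∀ s' : ℕ → ℝ, ∃ φ : ℕ → ℕ, StrictMono φ ∧ ∃ f' : ℝ → X,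
      (∀ t : ℝ, Tendsto (fun n => f (t + s' (φ n))) atTop (𝓝 (f' t))) ∧
      (∀ t : ℝ, Tendsto (fun n => f' (t - s' (φ n))) atTop (𝓝 (f t)))

/-- Compact almost automorphic functions on the real line: both limits are uniform on every
compact set of times. -/
def IsCompactAlmostAutomorphic (f : ℝ → X) : Prop :=
  Continuous f ∧
    ∀ s' : ℕ → ℝ, ∃ φ : ℕ → ℕ, StrictMono φ ∧ ∃ f' : ℝ → X,
      ∀ K : Set ℝ, IsCompact K →
        TendstoUniformlyOn (fun n t => f (t + s' (φ n))) f' atTop K ∧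
        TendstoUniformlyOn (fun n t => f' (t - s' (φ n))) f atTop K

/-- The class of functions continuous on each `[n, n + 1)` with a left limit at each integer. -/
def IsPCZ (f : ℝ → X) : Prop :=
  (∀ n : ℤ, ContinuousOn f (Ico (n : ℝ) ((n : ℝ) + 1))) ∧
    ∀ n : ℤ, ∃ l : X, Tendsto f (𝓝[<] (n : ℝ)) (𝓝 l)

/-- `ℤ`-almost automorphic functions: only integer translations are considered. -/
def IsZAlmostAutomorphic (f : ℝ → X) : Prop :=
  IsPCZ f ∧
    ∀ s' : ℕ → ℤ, ∃ φ : ℕ → ℕ, StrictMono φ ∧ ∃ f' : ℝ → X,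
      (∀ t : ℝ, Tendsto (fun n => f (t + (s' (φ n) : ℝ))) atTop (𝓝 (f' t))) ∧
      (∀ t : ℝ, Tendsto (fun n => f' (t - (s' (φ n) : ℝ))) atTop (𝓝 (f t)))

/-- Discrete Bi-almost automorphic functions of two integer variables. -/
def IsBiAlmostAutomorphic (G : ℤ → ℤ → X) : Prop :=
  ∀ s' : ℕ → ℤ, ∃ φ : ℕ → ℕ, StrictMono φ ∧ ∃ G' : ℤ → ℤ → X,
    (∀ k m : ℤ, Tendsto (fun n => G (k + s' (φ n)) (m + s' (φ n))) atTop (𝓝 (G' k m))) ∧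
    (∀ k m : ℤ, Tendsto (fun n => G' (k - s' (φ n)) (m - s' (φ n))) atTop (𝓝 (G k m)))

end Functions

section Equations

variable {p : ℕ}

/-- `Φ` is a fundamental matrix solution of the linear system `y' = A(t) y`. -/
def IsFundamentalMatrix (A Φ : ℝ → Matrix (Fin p) (Fin p) ℂ) : Prop :=
  (∀ t : ℝ, HasDerivAt Φ (A t * Φ t) t) ∧ ∀ t : ℝ, IsUnit (Φ t)

/-- The transition matrix `Φ(t, s) = Φ(t) Φ(s)⁻¹`. -/
noncomputable def transition (Φ : ℝ → Matrix (Fin p) (Fin p) ℂ) (t s : ℝ) :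
    Matrix (Fin p) (Fin p) ℂ :=
  Φ t * (Φ s)⁻¹

/-- The coefficient `C(n) = Φ(n + 1, n) + ∫_n^{n+1} Φ(n + 1, u) B(u) du` of the difference
equation satisfied by the values at the integers. -/
noncomputable def coeffC (B Φ : ℝ → Matrix (Fin p) (Fin p) ℂ) (n : ℤ) :
    Matrix (Fin p) (Fin p) ℂ :=
  transition Φ ((n : ℝ) + 1) n +
    ∫ u in (n : ℝ)..((n : ℝ) + 1), transition Φ ((n : ℝ) + 1) u * B u

/-- `Y` is a fundamental matrix solution of the difference system `y(n + 1) = C(n) y(n)`. -/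
def IsDiscreteFundamentalMatrix (C Y : ℤ → Matrix (Fin p) (Fin p) ℂ) : Prop :=
  (∀ n : ℤ, Y (n + 1) = C n * Y n) ∧ ∀ n : ℤ, IsUnit (Y n)

/-- The discrete Green function of the fundamental matrix `Y` and the projection `P`. -/
noncomputable def green (Y : ℤ → Matrix (Fin p) (Fin p) ℂ) (P : Matrix (Fin p) (Fin p) ℂ)
    (n m : ℤ) : Matrix (Fin p) (Fin p) ℂ :=
  if m ≤ n then Y n * P * (Y m)⁻¹ else -(Y n * (1 - P) * (Y m)⁻¹)

/-- The system `y(n + 1) = C(n) y(n)` has a Bi-almost automorphic exponential dichotomy with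
parameters `(α, K, P)`. -/
def HasBiAAExpDichotomy (C : ℤ → Matrix (Fin p) (Fin p) ℂ) (α K : ℝ)
    (P : Matrix (Fin p) (Fin p) ℂ) : Prop :=
  0 < α ∧ 0 < K ∧ P * P = P ∧
    ∃ Y : ℤ → Matrix (Fin p) (Fin p) ℂ, IsDiscreteFundamentalMatrix C Y ∧
      (∀ n m : ℤ, ‖green Y P n m‖ ≤ K * Real.exp (-α * |(n : ℝ) - (m : ℝ)|)) ∧
      IsBiAlmostAutomorphic (green Y P)

/-- The right-hand side `A(t) y(t) + B(t) y([t]) + f(t)`. -/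
noncomputable def linearRHS (A B : ℝ → Matrix (Fin p) (Fin p) ℂ) (f y : ℝ → Fin p → ℂ)
    (t : ℝ) : Fin p → ℂ :=
  (A t).mulVec (y t) + (B t).mulVec (y (⌊t⌋ : ℝ)) + f t

/-- `y` is a solution on `ℝ` of `y'(t) = A(t) y(t) + B(t) y([t]) + f(t)`: it is continuous,
satisfies the equation on every open interval `(n, n + 1)`, and satisfies it at every integer
with the right-hand derivative. -/
def IsSolution (A B : ℝ → Matrix (Fin p) (Fin p) ℂ) (f y : ℝ → Fin p → ℂ) : Prop :=
  Continuous y ∧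
    (∀ n : ℤ, ∀ t ∈ Ioo (n : ℝ) ((n : ℝ) + 1), HasDerivAt y (linearRHS A B f y t) t) ∧
    ∀ n : ℤ, HasDerivWithinAt y (linearRHS A B f y n) (Ici (n : ℝ)) n

end Equations

end DEPCA

/-!
On each interval `[n, n + 1)` the equation is a linear ordinary differential equation with forcing
term `B(t) y(n) + f(t)`, so by variation of constants (`stepSol`) the values at the integers satisfy
`y(n + 1) = C(n) y(n) + h(n)`, where `h` (`forcing`) only depends on `A` and `f`.

*Uniqueness.* The difference of two bounded solutions gives a bounded solution of the homogeneous
difference equation. By the dichotomy it vanishes (`eq_zero_of_bounded_of_dichotomy`), and then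
so does the difference on every interval (`IsSolution.eq_of_bounded`). Compact almost automorphic
functions are bounded.

*Existence.* The series `x(k) = ∑ G(k, m) h(m - 1)` (`greenSum`) is a bounded solution of the
difference equation, and the pieces started at `x(n)` fit together to a solution `y` (`glued`). It
is bounded with bounded right derivative, hence Lipschitz. For Lipschitz functions pointwise almost
automorphy along *integer* sequences already implies compact almost automorphy
(`isCompactAlmostAutomorphic_of_lipschitzWith`).

For integer sequences, the limits of `A`, `B` and `f` along translations are only bounded and
measurable, so the limit equations are read in integrated form on `[0, 1]` (`IsMild`). Grönwall's
inequality and dominated convergence show that solutions depend continuously on bounded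
coefficients with respect to pointwise convergence (`IsMild.exists_tendsto`). As this
applies to the equation and to its limit equation alike, both limits in the definition of almost
automorphy pass from the data to the solutions (`IsMild.exists_shiftLimit`). This is used first for
`h` and, after dominated convergence in the Green series (`ShiftLimit.greenSum`), for `y`.
-/

namespace DEPCA

/-! ### Two-sided limits along integer translations -/

section ShiftLimit

variable {X Y Z : Type*} [TopologicalSpace X] [TopologicalSpace Y] [TopologicalSpace Z]

/-- `F'` is the limit of the translates of `F` by `s n`, and `F` is the limit of the translates of
`F'` by `-s n`. Taking `X` to be a space of functions with the topology of pointwise convergence,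
this covers functions of a real variable and functions of two integer variables as well. -/
def ShiftLimit (s : ℕ → ℤ) (F F' : ℤ → X) : Prop :=
  (∀ m, Tendsto (fun n => F (m + s n)) atTop (𝓝 (F' m))) ∧
    ∀ m, Tendsto (fun n => F' (m - s n)) atTop (𝓝 (F m))

theorem ShiftLimit.subseq {s : ℕ → ℤ} {F F' : ℤ → X} (h : ShiftLimit s F F') {φ : ℕ → ℕ}
    (hφ : StrictMono φ) : ShiftLimit (s ∘ φ) F F' :=
  ⟨fun m => (h.1 m).comp hφ.tendsto_atTop, fun m => (h.2 m).comp hφ.tendsto_atTop⟩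

theorem ShiftLimit.map {s : ℕ → ℤ} {F F' : ℤ → X} (h : ShiftLimit s F F') {g : X → Y}
    (hg : Continuous g) : ShiftLimit s (fun m => g (F m)) (fun m => g (F' m)) :=
  ⟨fun m => (hg.tendsto _).comp (h.1 m), fun m => (hg.tendsto _).comp (h.2 m)⟩

theorem ShiftLimit.map₂ {s : ℕ → ℤ} {F F' : ℤ → X} {H H' : ℤ → Y} (h : ShiftLimit s F F')
    (h' : ShiftLimit s H H') {g : X → Y → Z} (hg : Continuous fun q : X × Y => g q.1 q.2) :
    ShiftLimit s (fun m => g (F m) (H m)) (fun m => g (F' m) (H' m)) :=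
  ⟨fun m => (hg.tendsto (F' m, H' m)).comp ((h.1 m).prodMk_nhds (h'.1 m)),
    fun m => (hg.tendsto (F m, H m)).comp ((h.2 m).prodMk_nhds (h'.2 m))⟩

theorem ShiftLimit.pi {ι : Type*} {s : ℕ → ℤ} {F F' : ℤ → ι → X}
    (h : ∀ i, ShiftLimit s (fun m => F m i) (fun m => F' m i)) : ShiftLimit s F F' :=
  ⟨fun m => tendsto_pi_nhds.2 fun i => (h i).1 m, fun m => tendsto_pi_nhds.2 fun i => (h i).2 m⟩

theorem ShiftLimit.apply {ι : Type*} {s : ℕ → ℤ} {F F' : ℤ → ι → X}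
    (h : ShiftLimit s F F') (i : ι) : ShiftLimit s (fun m => F m i) (fun m => F' m i) :=
  h.map (continuous_apply i)

end ShiftLimit

/-- A function all of whose sequences of values have convergent subsequences is bounded. -/
theorem exists_norm_le_of_subseq_tendsto {ι X : Type*} [NormedAddCommGroup X] {f : ι → X}
    (h : ∀ s : ℕ → ι, ∃ φ : ℕ → ℕ, StrictMono φ ∧ ∃ x, Tendsto (fun n => f (s (φ n))) atTop (𝓝 x)) :
    ∃ M : ℝ, ∀ t, ‖f t‖ ≤ M := by
  by_contra! hne
  choose s hs using fun n : ℕ => hne n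
  obtain ⟨φ, hφ, x, hx⟩ := h s
  refine not_tendsto_atTop_of_tendsto_nhds hx.norm ?_
  refine tendsto_atTop_mono (fun n => (hs (φ n)).le) ?_
  exact tendsto_natCast_atTop_atTop.comp hφ.tendsto_atTop

/-! ### Bounded measurable coefficients and integral equations on the unit interval -/

section Mild

/-- `a` is strongly measurable and bounded by `M`. The limit of the translates of a continuous
almost automorphic function lies in this class, though it need not be continuous. -/
def IsBddMeasurable {X : Type*} [NormedAddCommGroup X] (M : ℝ) (a : ℝ → X) : Prop :=
  StronglyMeasurable a ∧ ∀ t, ‖a t‖ ≤ M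

theorem IsBddMeasurable.of_tendsto {X : Type*} [NormedAddCommGroup X] {M : ℝ} {a : ℕ → ℝ → X}
    {a' : ℝ → X} (h : ∀ n, IsBddMeasurable M (a n)) (ha : Tendsto a atTop (𝓝 a')) :
    IsBddMeasurable M a' :=
  ⟨stronglyMeasurable_of_tendsto atTop (fun n => (h n).1) ha, fun t =>
    le_of_tendsto (tendsto_pi_nhds.1 ha t).norm (Eventually.of_forall fun n => (h n).2 t)⟩

theorem IsBddMeasurable.comp_const_add {X : Type*} [NormedAddCommGroup X] {M : ℝ} {a : ℝ → X}
    (h : IsBddMeasurable M a) (c : ℝ) : IsBddMeasurable M (fun t => a (c + t)) :=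
  ⟨h.1.comp_measurable (measurable_const_add c), fun _ => h.2 _⟩

theorem IsBddMeasurable.nonneg {X : Type*} [NormedAddCommGroup X] {M : ℝ} {a : ℝ → X}
    (h : IsBddMeasurable M a) : 0 ≤ M :=
  (norm_nonneg _).trans (h.2 0)

variable {E : Type*} [NormedAddCommGroup E] [NormedSpace ℝ E]

/-- `z` solves `z' = a z + g`, `z(0) = ζ` on `[0, 1]` in integrated form. -/
structure IsMild (a : ℝ → E →L[ℝ] E) (g : ℝ → E) (ζ : E) (z : ℝ → E) : Prop where
  cont : ContinuousOn z (Icc 0 1)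
  eq : ∀ t ∈ Icc (0 : ℝ) 1, z t = ζ + ∫ u in (0 : ℝ)..t, (a u (z u) + g u)

/-- Grönwall's inequality in integral form on `[0, 1]`. -/
theorem le_mul_exp_of_le_add_integral {u : ℝ → ℝ} {δ M : ℝ} (hM : 0 ≤ M)
    (hu : ContinuousOn u (Icc 0 1))
    (h : ∀ t ∈ Icc (0 : ℝ) 1, u t ≤ δ + M * ∫ x in (0 : ℝ)..t, u x) :
    ∀ t ∈ Icc (0 : ℝ) 1, u t ≤ δ * Real.exp (M * t) := by
  set V : ℝ → ℝ := fun t => δ + M * ∫ x in (0 : ℝ)..t, u x with hV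
  have hint : IntegrableOn u (Icc 0 1) := hu.integrableOn_Icc
  have hVc : ContinuousOn V (Icc 0 1) :=
    continuousOn_const.add (continuousOn_const.mul (intervalIntegral.continuousOn_primitive_interval
      (by rwa [uIcc_of_le zero_le_one])  |>.mono (by rw [uIcc_of_le zero_le_one])))
  have hVd : ∀ t ∈ Ico (0 : ℝ) 1, HasDerivWithinAt V (M * u t) (Ici t) t := by
    intro t ht
    have hI : IntervalIntegrable u volume 0 t := by
      rw [intervalIntegrable_iff_integrableOn_Icc_of_le ht.1]
      exact hint.mono_set (Icc_subset_Icc_right ht.2.le)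
    have hmem : Icc (0 : ℝ) 1 ∈ 𝓝[>] t :=
      mem_of_superset (Ioo_mem_nhdsGT ht.2) fun x hx => ⟨ht.1.trans hx.1.le, hx.2.le⟩
    have hc : ContinuousWithinAt u (Ioi t) t :=
      (hu t ⟨ht.1, ht.2.le⟩).mono_of_mem_nhdsWithin hmem
    have := intervalIntegral.integral_hasDerivWithinAt_right (s := Ici t) (t := Ioi t) hI
      ⟨_, hmem, hint.aestronglyMeasurable⟩ hc
    exact (this.const_mul M).const_add δ
  have key := le_gronwallBound_of_liminf_deriv_right_le (f := V) (f' := fun t => M * u t)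
    (δ := δ) (K := M) (ε := 0) hVc (fun x hx r hr => (hVd x hx).liminf_right_slope_le hr)
    (by simp [hV]) (fun x hx => by
      rw [add_zero]
      exact mul_le_mul_of_nonneg_left (h x ⟨hx.1, hx.2.le⟩) hM)
  intro t ht
  have := key t ht
  rw [gronwallBound_ε0, sub_zero] at this
  exact (h t ht).trans this

variable {a b : ℝ → E →L[ℝ] E} {g k z w : ℝ → E} {ζ ω : E} {M N R : ℝ}

theorem intervalIntegrable_apply_add (ha : IsBddMeasurable M a) (hg : IsBddMeasurable N g)
    (hz : AEStronglyMeasurable z (volume.restrict (Icc 0 1)))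
    (hR : ∀ t ∈ Icc (0 : ℝ) 1, ‖z t‖ ≤ R) {t : ℝ} (ht : t ∈ Icc (0 : ℝ) 1) :
    IntervalIntegrable (fun u => a u (z u) + g u) volume 0 t := by
  rw [intervalIntegrable_iff_integrableOn_Icc_of_le ht.1]
  refine IntegrableOn.mono_set (t := Icc 0 1) ?_ (Icc_subset_Icc_right ht.2)
  refine Integrable.of_bound (C := M * R + N) ?_ ?_
  · exact (isBoundedBilinearMap_apply.continuous.comp_aestronglyMeasurable
      (ha.1.aestronglyMeasurable.prodMk hz)).add hg.1.aestronglyMeasurable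
  · refine (ae_restrict_iff' measurableSet_Icc).2 (Eventually.of_forall fun u hu => ?_)
    refine (norm_add_le _ _).trans (add_le_add ?_ (hg.2 u))
    exact ((a u).le_opNorm _).trans
      (mul_le_mul (ha.2 u) (hR u hu) (norm_nonneg _) ha.nonneg)

theorem IsMild.exists_bound (hz : IsMild a g ζ z) : ∃ R, ∀ t ∈ Icc (0 : ℝ) 1, ‖z t‖ ≤ R :=
  isCompact_Icc.exists_bound_of_continuousOn hz.cont

theorem IsMild.aestronglyMeasurable (hz : IsMild a g ζ z) :
    AEStronglyMeasurable z (volume.restrict (Icc 0 1)) :=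
  hz.cont.aestronglyMeasurable measurableSet_Icc

theorem IsMild.intervalIntegrable (hz : IsMild a g ζ z) (ha : IsBddMeasurable M a)
    (hg : IsBddMeasurable N g) {t : ℝ} (ht : t ∈ Icc (0 : ℝ) 1) :
    IntervalIntegrable (fun u => a u (z u) + g u) volume 0 t :=
  intervalIntegrable_apply_add ha hg hz.aestronglyMeasurable hz.exists_bound.choose_spec ht

/-- The `L¹` distance of the data of two integral equations, the second of which has a solution
bounded by `R`. -/
noncomputable def dataDist (R : ℝ) (a b : ℝ → E →L[ℝ] E) (g k : ℝ → E) (ζ ω : E) : ℝ :=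
  ‖ζ - ω‖ + ∫ u in (0 : ℝ)..1, (‖a u - b u‖ * R + ‖g u - k u‖)

theorem intervalIntegrable_norm_sub (ha : IsBddMeasurable M a) (hb : IsBddMeasurable M b)
    (hg : IsBddMeasurable N g) (hk : IsBddMeasurable N k) (R x y : ℝ) :
    IntervalIntegrable (fun u => ‖a u - b u‖ * R + ‖g u - k u‖) volume x y := by
  refine IntervalIntegrable.add (IntervalIntegrable.mul_const ?_ R) ?_
  · refine intervalIntegrable_iff.2 (Measure.integrableOn_of_bounded (M := M + M) (by simp)
      (ha.1.sub hb.1).norm.aestronglyMeasurable (Eventually.of_forall fun u => ?_))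
    rw [norm_norm]
    exact (norm_sub_le _ _).trans (add_le_add (ha.2 u) (hb.2 u))
  · refine intervalIntegrable_iff.2 (Measure.integrableOn_of_bounded (M := N + N) (by simp)
      (hg.1.sub hk.1).norm.aestronglyMeasurable (Eventually.of_forall fun u => ?_))
    rw [norm_norm]
    exact (norm_sub_le _ _).trans (add_le_add (hg.2 u) (hk.2 u))

/-- Stability of the integral equation with respect to its data, from Grönwall's inequality. -/
theorem IsMild.norm_sub_le (ha : IsBddMeasurable M a) (hb : IsBddMeasurable M b)
    (hg : IsBddMeasurable N g) (hk : IsBddMeasurable N k) (hz : IsMild a g ζ z)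
    (hw : IsMild b k ω w) (hR : ∀ t ∈ Icc (0 : ℝ) 1, ‖w t‖ ≤ R) :
    ∀ t ∈ Icc (0 : ℝ) 1, ‖z t - w t‖ ≤ dataDist R a b g k ζ ω * Real.exp M := by
  have hR0 : 0 ≤ R := (norm_nonneg _).trans (hR 0 ⟨le_rfl, zero_le_one⟩)
  have hM := ha.nonneg
  have hcont : ContinuousOn (fun t => ‖z t - w t‖) (Icc 0 1) := (hz.cont.sub hw.cont).norm
  have hD : ∀ t ∈ Icc (0 : ℝ) 1,
      ∫ u in (0 : ℝ)..t, (‖a u - b u‖ * R + ‖g u - k u‖) ≤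
        ∫ u in (0 : ℝ)..1, (‖a u - b u‖ * R + ‖g u - k u‖) := by
    intro t ht
    refine intervalIntegral.integral_mono_interval le_rfl ht.1 ht.2
      (Eventually.of_forall fun u => by positivity) (intervalIntegrable_norm_sub ha hb hg hk R 0 1)
  have hδ : 0 ≤ dataDist R a b g k ζ ω :=
    add_nonneg (norm_nonneg _)
      (intervalIntegral.integral_nonneg zero_le_one fun u _ => by positivity)
  have key := le_mul_exp_of_le_add_integral (u := fun t => ‖z t - w t‖)
    (δ := dataDist R a b g k ζ ω) hM hcont ?_
  · intro t ht
    refine (key t ht).trans (mul_le_mul_of_nonneg_left (Real.exp_le_exp.2 ?_) hδ)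
    exact mul_le_of_le_one_right hM ht.2
  · intro t ht
    have hiu : IntervalIntegrable (fun u => ‖z u - w u‖) volume 0 t := by
      rw [intervalIntegrable_iff_integrableOn_Icc_of_le ht.1]
      exact hcont.integrableOn_Icc.mono_set (Icc_subset_Icc_right ht.2)
    have h1 : z t - w t = (ζ - ω) +
        ∫ u in (0 : ℝ)..t, ((a u (z u) + g u) - (b u (w u) + k u)) := by
      rw [intervalIntegral.integral_sub (hz.intervalIntegrable ha hg ht)
        (hw.intervalIntegrable hb hk ht), hz.eq t ht, hw.eq t ht]
      abel
    have h2 : ‖∫ u in (0 : ℝ)..t, ((a u (z u) + g u) - (b u (w u) + k u))‖ ≤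
        ∫ u in (0 : ℝ)..t, (M * ‖z u - w u‖ + (‖a u - b u‖ * R + ‖g u - k u‖)) := by
      refine intervalIntegral.norm_integral_le_of_norm_le ht.1
        (Eventually.of_forall fun u hu => ?_)
        ((hiu.const_mul M).add (intervalIntegrable_norm_sub ha hb hg hk R 0 t))
      have hu' : u ∈ Icc (0 : ℝ) 1 := ⟨hu.1.le, hu.2.trans ht.2⟩
      have : (a u (z u) + g u) - (b u (w u) + k u) =
          a u (z u - w u) + ((a u - b u) (w u) + (g u - k u)) := by
        simp only [map_sub, sub_apply]
        abel
      rw [this]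
      refine (norm_add_le _ _).trans (add_le_add ?_ ((norm_add_le _ _).trans
        (add_le_add ?_ le_rfl)))
      · exact ((a u).le_opNorm _).trans (mul_le_mul_of_nonneg_right (ha.2 u) (norm_nonneg _))
      · exact ((a u - b u).le_opNorm _).trans
          (mul_le_mul_of_nonneg_left (hR u hu') (norm_nonneg _))
    rw [intervalIntegral.integral_add (hiu.const_mul M)
      (intervalIntegrable_norm_sub ha hb hg hk R 0 t), intervalIntegral.integral_const_mul] at h2
    rw [h1]
    refine (norm_add_le _ _).trans ?_
    have := hD t ht
    unfold dataDist
    linarith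

theorem IsMild.eqOn (ha : IsBddMeasurable M a) (hg : IsBddMeasurable N g) (hz : IsMild a g ζ z)
    (hw : IsMild a g ζ w) : EqOn z w (Icc 0 1) := by
  intro t ht
  obtain ⟨R, hR⟩ := hw.exists_bound
  have := hz.norm_sub_le ha ha hg hg hw hR t ht
  simp only [dataDist, sub_self, norm_zero, zero_mul, add_zero,
    intervalIntegral.integral_zero] at this
  exact sub_eq_zero.1 (norm_le_zero_iff.1 this)

/-- An a priori bound for solutions in terms of bounds on the data. -/
theorem IsMild.norm_le (ha : IsBddMeasurable M a) (hg : IsBddMeasurable N g)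
    (hz : IsMild a g ζ z) {L : ℝ} (hζ : ‖ζ‖ ≤ L) :
    ∀ t ∈ Icc (0 : ℝ) 1, ‖z t‖ ≤ (L + N) * Real.exp M := by
  intro t ht
  -- Compare with the zero solution of the homogeneous equation.
  have h0 : IsMild a (fun _ => (0 : E)) 0 (fun _ => 0) := ⟨continuousOn_const, fun t _ => by simp⟩
  have h0b : IsBddMeasurable N (fun _ : ℝ => (0 : E)) :=
    ⟨stronglyMeasurable_const, fun t => by simpa using hg.nonneg⟩
  have := hz.norm_sub_le ha ha hg h0b h0 (R := 0) (by simp) t ht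
  rw [sub_zero] at this
  refine this.trans (mul_le_mul_of_nonneg_right (add_le_add (by simpa using hζ) ?_)
    (Real.exp_pos _).le)
  refine (Real.le_norm_self _).trans ((intervalIntegral.norm_integral_le_of_norm_le_const
    (C := N) fun u _ => ?_).trans (by simp))
  simpa using hg.2 u

theorem tendsto_dataDist {a : ℕ → ℝ → E →L[ℝ] E} {a' : ℝ → E →L[ℝ] E} {g : ℕ → ℝ → E}
    {g' : ℝ → E} {ζ : ℕ → E} {ζ' : E} (ha : ∀ n, IsBddMeasurable M (a n))
    (hg : ∀ n, IsBddMeasurable N (g n)) (ha' : Tendsto a atTop (𝓝 a'))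
    (hg' : Tendsto g atTop (𝓝 g')) (hζ : Tendsto ζ atTop (𝓝 ζ')) (hR : 0 ≤ R) :
    Tendsto (fun n => dataDist R (a n) a' (g n) g' (ζ n) ζ') atTop (𝓝 0) := by
  have hba := IsBddMeasurable.of_tendsto ha ha'
  have hbg := IsBddMeasurable.of_tendsto hg hg'
  have h1 : Tendsto (fun n => ‖ζ n - ζ'‖) atTop (𝓝 0) := by
    simpa using (hζ.sub_const ζ').norm
  have h2 : Tendsto (fun n => ∫ u in (0 : ℝ)..1, (‖a n u - a' u‖ * R + ‖g n u - g' u‖)) atTop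
      (𝓝 (∫ u in (0 : ℝ)..1, (0 : ℝ))) := by
    refine intervalIntegral.tendsto_integral_filter_of_dominated_convergence
      (fun _ => (M + M) * R + (N + N)) (Eventually.of_forall fun n => ?_)
      (Eventually.of_forall fun n => Eventually.of_forall fun u _ => ?_)
      (intervalIntegrable_const) (Eventually.of_forall fun u _ => ?_)
    · exact ((((ha n).1.sub hba.1).norm.mul_const R).add
        ((hg n).1.sub hbg.1).norm).aestronglyMeasurable
    · rw [Real.norm_of_nonneg (by positivity)]
      exact add_le_add (mul_le_mul_of_nonneg_right ((norm_sub_le _ _).trans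
        (add_le_add ((ha n).2 u) (hba.2 u))) hR)
        ((norm_sub_le _ _).trans (add_le_add ((hg n).2 u) (hbg.2 u)))
    · have e1 := ((tendsto_pi_nhds.1 ha' u).sub_const (a' u)).norm.mul_const R
      have e2 := ((tendsto_pi_nhds.1 hg' u).sub_const (g' u)).norm
      simpa using e1.add e2
  simpa [dataDist] using h1.add h2

theorem dataDist_triangle {c : ℝ → E →L[ℝ] E} {l : ℝ → E} {χ : E}
    (ha : IsBddMeasurable M a) (hb : IsBddMeasurable M b) (hc : IsBddMeasurable M c)
    (hg : IsBddMeasurable N g) (hk : IsBddMeasurable N k) (hl : IsBddMeasurable N l)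
    (hR : 0 ≤ R) :
    dataDist R a b g k ζ ω ≤ dataDist R a c g l ζ χ + dataDist R b c k l ω χ := by
  have h1 : ‖ζ - ω‖ ≤ ‖ζ - χ‖ + ‖ω - χ‖ := by
    simpa [norm_sub_rev ω χ] using norm_sub_le_norm_sub_add_norm_sub ζ χ ω
  have h2 : ∫ u in (0 : ℝ)..1, (‖a u - b u‖ * R + ‖g u - k u‖) ≤
      (∫ u in (0 : ℝ)..1, (‖a u - c u‖ * R + ‖g u - l u‖)) +
        ∫ u in (0 : ℝ)..1, (‖b u - c u‖ * R + ‖k u - l u‖) := by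
    rw [← intervalIntegral.integral_add (intervalIntegrable_norm_sub ha hc hg hl R 0 1)
      (intervalIntegrable_norm_sub hb hc hk hl R 0 1)]
    refine intervalIntegral.integral_mono_on zero_le_one
      (intervalIntegrable_norm_sub ha hb hg hk R 0 1)
      ((intervalIntegrable_norm_sub ha hc hg hl R 0 1).add
        (intervalIntegrable_norm_sub hb hc hk hl R 0 1)) fun u _ => ?_
    have e1 : ‖a u - b u‖ ≤ ‖a u - c u‖ + ‖b u - c u‖ := by
      simpa [norm_sub_rev (b u) (c u)] using norm_sub_le_norm_sub_add_norm_sub (a u) (c u) (b u)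
    have e2 : ‖g u - k u‖ ≤ ‖g u - l u‖ + ‖k u - l u‖ := by
      simpa [norm_sub_rev (k u) (l u)] using norm_sub_le_norm_sub_add_norm_sub (g u) (l u) (k u)
    have e3 := mul_le_mul_of_nonneg_right e1 hR
    linarith
  unfold dataDist
  linarith

/-- Continuous dependence on the data under bounded pointwise convergence of the coefficients.
The solution of the limit equation is obtained as the limit of a Cauchy sequence, so that no
separate existence theorem for measurable coefficients is needed. -/
theorem IsMild.exists_tendsto [CompleteSpace E] {a : ℕ → ℝ → E →L[ℝ] E} {a' : ℝ → E →L[ℝ] E}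
    {g : ℕ → ℝ → E} {g' : ℝ → E} {ζ : ℕ → E} {ζ' : E} {z : ℕ → ℝ → E}
    (ha : ∀ n, IsBddMeasurable M (a n)) (hg : ∀ n, IsBddMeasurable N (g n))
    (hz : ∀ n, IsMild (a n) (g n) (ζ n) (z n)) (ha' : Tendsto a atTop (𝓝 a'))
    (hg' : Tendsto g atTop (𝓝 g')) (hζ : Tendsto ζ atTop (𝓝 ζ')) :
    ∃ z', IsMild a' g' ζ' z' ∧
      ∀ t ∈ Icc (0 : ℝ) 1, Tendsto (fun n => z n t) atTop (𝓝 (z' t)) := by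
  have hba := IsBddMeasurable.of_tendsto ha ha'
  have hbg := IsBddMeasurable.of_tendsto hg hg'
  obtain ⟨L, hL⟩ := hζ.norm.bddAbove_range
  have hLn : ∀ n, ‖ζ n‖ ≤ L := fun n => hL ⟨n, rfl⟩
  set R : ℝ := (L + N) * Real.exp M with hRdef
  have hR : ∀ n, ∀ t ∈ Icc (0 : ℝ) 1, ‖z n t‖ ≤ R := fun n =>
    (hz n).norm_le (ha n) (hg n) (hLn n)
  have hR0 : 0 ≤ R := (norm_nonneg _).trans (hR 0 0 ⟨le_rfl, zero_le_one⟩)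
  set ε : ℕ → ℝ := fun n => dataDist R (a n) a' (g n) g' (ζ n) ζ' with hε
  have hε0 : Tendsto ε atTop (𝓝 0) := tendsto_dataDist ha hg ha' hg' hζ hR0
  have hdist : ∀ t ∈ Icc (0 : ℝ) 1, ∀ m n, ‖z m t - z n t‖ ≤ (ε m + ε n) * Real.exp M := by
    intro t ht m n
    refine ((hz m).norm_sub_le (ha m) (ha n) (hg m) (hg n) (hz n) (hR n) t ht).trans ?_
    exact mul_le_mul_of_nonneg_right
      (dataDist_triangle (ha m) (ha n) hba (hg m) (hg n) hbg hR0) (Real.exp_pos _).le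
  have hcau : ∀ t ∈ Icc (0 : ℝ) 1, ∃ x, Tendsto (fun n => z n t) atTop (𝓝 x) := by
    intro t ht
    refine cauchySeq_tendsto_of_complete (cauchySeq_iff_tendsto_dist_atTop_0.2 ?_)
    have h0 : Tendsto (fun q : ℕ × ℕ => (ε q.1 + ε q.2) * Real.exp M) atTop (𝓝 0) := by
      have := ((hε0.comp (tendsto_fst (g := atTop (α := ℕ)))).add
        (hε0.comp (tendsto_snd (f := atTop (α := ℕ))))).mul_const (Real.exp M)
      rw [prod_atTop_atTop_eq] at this
      simpa using this
    refine squeeze_zero (fun _ => dist_nonneg) (fun q => ?_) h0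
    rw [dist_eq_norm]
    exact hdist t ht q.1 q.2
  choose! z' hz' using hcau
  have hR' : ∀ t ∈ Icc (0 : ℝ) 1, ‖z' t‖ ≤ R := fun t ht =>
    le_of_tendsto (hz' t ht).norm (Eventually.of_forall fun n => hR n t ht)
  have hm' : AEStronglyMeasurable z' (volume.restrict (Icc 0 1)) := by
    refine aestronglyMeasurable_of_tendsto_ae atTop (fun n => (hz n).aestronglyMeasurable) ?_
    exact (ae_restrict_iff' measurableSet_Icc).2 (Eventually.of_forall hz')
  have heq : ∀ t ∈ Icc (0 : ℝ) 1, z' t = ζ' + ∫ u in (0 : ℝ)..t, (a' u (z' u) + g' u) := by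
    intro t ht
    refine tendsto_nhds_unique (hz' t ht) ?_
    simp_rw [fun n => (hz n).eq t ht]
    refine hζ.add (intervalIntegral.tendsto_integral_filter_of_dominated_convergence
      (fun _ => M * R + N) (Eventually.of_forall fun n => ?_)
      (Eventually.of_forall fun n => Eventually.of_forall fun u hu => ?_)
      intervalIntegrable_const (Eventually.of_forall fun u hu => ?_))
    · exact ((hz n).intervalIntegrable (ha n) (hg n) ht).aestronglyMeasurable_restrict_uIoc
    · rw [uIoc_of_le ht.1] at hu
      exact (norm_add_le _ _).trans (add_le_add (((a n u).le_opNorm _).trans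
        (mul_le_mul ((ha n).2 u) (hR n u ⟨hu.1.le, hu.2.trans ht.2⟩) (norm_nonneg _)
          hba.nonneg)) ((hg n).2 u))
    · rw [uIoc_of_le ht.1] at hu
      exact ((isBoundedBilinearMap_apply.continuous.tendsto (a' u, z' u)).comp
        ((tendsto_pi_nhds.1 ha' u).prodMk_nhds (hz' u ⟨hu.1.le, hu.2.trans ht.2⟩))).add
        (tendsto_pi_nhds.1 hg' u)
  refine ⟨z', ⟨?_, heq⟩, hz'⟩
  refine ContinuousOn.congr ?_ heq
  have hI := intervalIntegrable_apply_add hba hbg hm' hR' (t := 1) ⟨zero_le_one, le_rfl⟩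
  refine continuousOn_const.add ?_
  have := intervalIntegral.continuousOn_primitive_interval (a := 0) (b := 1) (μ := volume)
    (f := fun u => a' u (z' u) + g' u) ?_
  · rwa [uIcc_of_le zero_le_one] at this
  · rw [uIcc_of_le zero_le_one]
    exact (intervalIntegrable_iff_integrableOn_Icc_of_le zero_le_one).1 hI

/-- Two-sided limits along translations pass from the data of the integral equations to the
solutions: the solution operator is the same for the equation and for its limit equation, so the
forward and the backward limits are both instances of continuous dependence. -/
theorem IsMild.exists_shiftLimit [CompleteSpace E] {s : ℕ → ℤ} {a a' : ℤ → ℝ → E →L[ℝ] E}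
    {g g' : ℤ → ℝ → E} {ζ ζ' : ℤ → E} {z : ℤ → ℝ → E}
    (ha : ∀ m, IsBddMeasurable M (a m)) (hg : ∀ m, IsBddMeasurable N (g m))
    (hz : ∀ m, IsMild (a m) (g m) (ζ m) (z m)) (ha' : ShiftLimit s a a')
    (hg' : ShiftLimit s g g') (hζ : ShiftLimit s ζ ζ') :
    ∃ z' : ℤ → ℝ → E, ∀ t ∈ Icc (0 : ℝ) 1,
      ShiftLimit s (fun m => z m t) (fun m => z' m t) := by
  have hba : ∀ m, IsBddMeasurable M (a' m) := fun m =>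
    IsBddMeasurable.of_tendsto (fun n => ha (m + s n)) (ha'.1 m)
  have hbg : ∀ m, IsBddMeasurable N (g' m) := fun m =>
    IsBddMeasurable.of_tendsto (fun n => hg (m + s n)) (hg'.1 m)
  choose z' hz' hlim using fun m : ℤ => IsMild.exists_tendsto (fun n => ha (m + s n))
    (fun n => hg (m + s n)) (fun n => hz (m + s n)) (ha'.1 m) (hg'.1 m) (hζ.1 m)
  refine ⟨z', fun t ht => ⟨fun m => hlim m t ht, fun m => ?_⟩⟩
  obtain ⟨w, hw, hwlim⟩ := IsMild.exists_tendsto (fun n => hba (m - s n))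
    (fun n => hbg (m - s n)) (fun n => hz' (m - s n)) (ha'.2 m) (hg'.2 m) (hζ.2 m)
  -- The limit `w` of the backward translates solves the original equation, so it is `z m`.
  simp only [(hz m).eqOn (ha m) (hg m) hw ht]
  exact hwlim t ht

end Mild

/-! ### From integer translations to compact almost automorphy -/

section Lipschitz

variable {X : Type*} [NormedAddCommGroup X]

theorem tendstoUniformlyOn_of_lipschitzWith {F : ℕ → ℝ → X} {f : ℝ → X} {L : NNReal}
    (hF : ∀ n, LipschitzWith L (F n)) (h : ∀ t, Tendsto (fun n => F n t) atTop (𝓝 (f t)))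
    {K : Set ℝ} (hK : IsCompact K) : TendstoUniformlyOn F f atTop K := by
  have hequi := (LipschitzWith.uniformEquicontinuous F L hF).equicontinuous
  have := (EquicontinuousOn.tendsto_uniformOnFun_iff_pi (F := F) (𝔖 := {K : Set ℝ | IsCompact K})
    (fun K hK => hK) (sUnion_eq_univ_iff.2 fun t => ⟨{t}, isCompact_singleton, rfl⟩)
    (fun K _ => hequi.equicontinuousOn K) atTop f).2 (tendsto_pi_nhds.2 h)
  exact UniformOnFun.tendsto_iff_tendstoUniformlyOn.1 this K hK

theorem lipschitzWith_of_tendsto {F : ℕ → ℝ → X} {f : ℝ → X} {L : NNReal}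
    (hF : ∀ n, LipschitzWith L (F n)) (h : ∀ t, Tendsto (fun n => F n t) atTop (𝓝 (f t))) :
    LipschitzWith L f :=
  LipschitzWith.of_dist_le_mul fun x y =>
    le_of_tendsto ((h x).dist (h y)) (Eventually.of_forall fun n => (hF n).dist_le_mul x y)

theorem lipschitzWith_comp_add {f : ℝ → X} {L : NNReal} (hf : LipschitzWith L f) (c : ℝ) :
    LipschitzWith L (fun t => f (t + c)) :=
  LipschitzWith.of_dist_le_mul fun x y => by
    simpa using hf.dist_le_mul (x + c) (y + c)

/-- If `f` is Lipschitz, perturbing the translation parameter by a null sequence does not affect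
limits. -/
theorem tendsto_lipschitz_perturb {f : ℕ → ℝ → X} {L : NNReal} (hf : ∀ n, LipschitzWith L (f n))
    {u v : ℕ → ℝ} {x : X} (hv : Tendsto (fun n => f n (v n)) atTop (𝓝 x))
    (huv : Tendsto (fun n => u n - v n) atTop (𝓝 0)) :
    Tendsto (fun n => f n (u n)) atTop (𝓝 x) := by
  refine hv.congr_dist ?_
  refine squeeze_zero (fun _ => dist_nonneg) (fun n => (hf n).dist_le_mul (v n) (u n)) ?_
  have : Tendsto (fun n => (L : ℝ) * |u n - v n|) atTop (𝓝 0) := by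
    simpa using (huv.abs).const_mul (L : ℝ)
  refine this.congr fun n => ?_
  rw [dist_comm, Real.dist_eq]

/-- A Lipschitz function which is almost automorphic with respect to integer translations is
compact almost automorphic: a real sequence splits into its integer parts and its fractional
parts, and the latter converge along a subsequence. -/
theorem isCompactAlmostAutomorphic_of_lipschitzWith {y : ℝ → X} {L : NNReal}
    (hL : LipschitzWith L y)
    (h : ∀ s' : ℕ → ℤ, ∃ φ : ℕ → ℕ, StrictMono φ ∧ ∃ y' : ℝ → X,
      (∀ t : ℝ, Tendsto (fun n => y (t + (s' (φ n) : ℝ))) atTop (𝓝 (y' t))) ∧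
      (∀ t : ℝ, Tendsto (fun n => y' (t - (s' (φ n) : ℝ))) atTop (𝓝 (y t)))) :
    IsCompactAlmostAutomorphic y := by
  refine ⟨hL.continuous, fun s' => ?_⟩
  obtain ⟨r, -, φ₁, hφ₁, hr⟩ := (isCompact_Icc (a := (0 : ℝ)) (b := 1)).tendsto_subseq
    (x := fun n => Int.fract (s' n)) fun n => ⟨Int.fract_nonneg _, (Int.fract_lt_one _).le⟩
  obtain ⟨φ₂, hφ₂, y', hf, hb⟩ := h fun n => ⌊s' (φ₁ n)⌋
  have hr2 : Tendsto (fun n => Int.fract (s' (φ₁ (φ₂ n)))) atTop (𝓝 r) :=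
    hr.comp hφ₂.tendsto_atTop
  have hy' : LipschitzWith L y' :=
    lipschitzWith_of_tendsto (fun n => lipschitzWith_comp_add hL _) hf
  refine ⟨φ₁ ∘ φ₂, hφ₁.comp hφ₂, fun t => y' (t + r), fun K hK => ⟨?_, ?_⟩⟩
  · refine tendstoUniformlyOn_of_lipschitzWith (fun n => lipschitzWith_comp_add hL _)
      (fun t => ?_) hK
    refine tendsto_lipschitz_perturb (f := fun _ => y) (fun _ => hL) (hf (t + r)) ?_
    have : Tendsto (fun n => Int.fract (s' (φ₁ (φ₂ n))) - r) atTop (𝓝 0) := by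
      simpa using hr2.sub_const r
    refine this.congr fun n => ?_
    simp only [Int.fract, Function.comp]
    ring
  · refine tendstoUniformlyOn_of_lipschitzWith
      (fun n => by simpa only [sub_eq_add_neg, add_assoc] using lipschitzWith_comp_add hy' _)
      (fun t => ?_) hK
    refine tendsto_lipschitz_perturb (f := fun _ => y') (fun _ => hy') (hb t) ?_
    have : Tendsto (fun n => r - Int.fract (s' (φ₁ (φ₂ n)))) atTop (𝓝 0) := by
      simpa using hr2.const_sub r
    refine this.congr fun n => ?_
    simp only [Int.fract, Function.comp]
    ring

end Lipschitz

/-! ### Bounded solutions of the difference equation -/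

section Discrete

theorem summable_exp_neg_mul_abs_int {α : ℝ} (hα : 0 < α) :
    Summable fun j : ℤ => Real.exp (-α * |(j : ℝ)|) := by
  have h : Summable fun n : ℕ => Real.exp (-α * n) := by
    simpa [mul_comm] using Real.summable_exp_nat_mul_iff.2 (neg_lt_zero.2 hα)
  refine Summable.of_nat_of_neg ?_ ?_ <;> simpa using h

theorem ShiftLimit.tsum {ι X : Type*} [NormedAddCommGroup X] [CompleteSpace X] {s : ℕ → ℤ}
    {F F' : ℤ → ι → X} {b : ι → ℝ} (hb : Summable b) (hF : ∀ m j, ‖F m j‖ ≤ b j)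
    (h : ShiftLimit s F F') : ShiftLimit s (fun m => ∑' j, F m j) (fun m => ∑' j, F' m j) := by
  have hF' : ∀ m j, ‖F' m j‖ ≤ b j := fun m j =>
    le_of_tendsto (tendsto_pi_nhds.1 (h.1 m) j).norm (Eventually.of_forall fun n => hF _ j)
  exact ⟨fun m => tendsto_tsum_of_dominated_convergence hb (tendsto_pi_nhds.1 (h.1 m))
      (Eventually.of_forall fun n => hF _),
    fun m => tendsto_tsum_of_dominated_convergence hb (tendsto_pi_nhds.1 (h.2 m))
      (Eventually.of_forall fun n => hF' _)⟩

variable {E : Type*} [NormedAddCommGroup E] [NormedSpace ℝ E]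

/-- The value at `k` of the bounded solution of `x(n + 1) = C(n) x(n) + h(n)` with Green function
`G`. The summation index is the offset `j = m - k` of the second argument `m` of `G`, so that
translating `k` translates each term. -/
noncomputable def greenSum (G : ℤ → ℤ → E →L[ℝ] E) (h : ℤ → E) (k : ℤ) : E :=
  ∑' j : ℤ, G k (k + j) (h (k + j - 1))

variable {G : ℤ → ℤ → E →L[ℝ] E} {h : ℤ → E} {α K H : ℝ}

theorem norm_green_apply_le (hG : ∀ n m : ℤ, ‖G n m‖ ≤ K * Real.exp (-α * |(n : ℝ) - m|))
    (hh : ∀ m, ‖h m‖ ≤ H) (k j : ℤ) :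
    ‖G k (k + j) (h (k + j - 1))‖ ≤ K * Real.exp (-α * |(j : ℝ)|) * H := by
  have h1 := hG k (k + j)
  have h2 : |(k : ℝ) - ((k + j : ℤ) : ℝ)| = |(j : ℝ)| := by
    push_cast
    rw [sub_add_cancel_left, abs_neg]
  rw [h2] at h1
  exact ((G k (k + j)).le_opNorm _).trans
    (mul_le_mul h1 (hh _) (norm_nonneg _) ((norm_nonneg _).trans h1))

theorem norm_greenSum_le (hα : 0 < α)
    (hG : ∀ n m : ℤ, ‖G n m‖ ≤ K * Real.exp (-α * |(n : ℝ) - m|))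
    (hh : ∀ m, ‖h m‖ ≤ H) (k : ℤ) :
    ‖greenSum G h k‖ ≤ ∑' j : ℤ, K * Real.exp (-α * |(j : ℝ)|) * H :=
  tsum_of_norm_bounded (((summable_exp_neg_mul_abs_int hα).mul_left K).mul_right H).hasSum
    (norm_green_apply_le hG hh k)

theorem ShiftLimit.greenSum [CompleteSpace E] {s : ℕ → ℤ} {G' : ℤ → ℤ → E →L[ℝ] E} {h' : ℤ → E}
    (hα : 0 < α) (hG : ∀ n m : ℤ, ‖G n m‖ ≤ K * Real.exp (-α * |(n : ℝ) - m|))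
    (hh : ∀ m, ‖h m‖ ≤ H)
    (hGl : ∀ j, ShiftLimit s (fun k => G k (k + j)) (fun k => G' k (k + j)))
    (hhl : ShiftLimit s h h') : ShiftLimit s (greenSum G h) (DEPCA.greenSum G' h') := by
  refine ShiftLimit.tsum (((summable_exp_neg_mul_abs_int hα).mul_left K).mul_right H)
    (norm_green_apply_le hG hh) (ShiftLimit.pi fun j => ?_)
  have hsh : ShiftLimit s (fun k => h (k + j - 1)) (fun k => h' (k + j - 1)) := by
    refine ⟨fun m => ?_, fun m => ?_⟩
    · convert hhl.1 (m + j - 1) using 3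
      ring
    · convert hhl.2 (m + j - 1) using 3
      ring
  exact (hGl j).map₂ hsh isBoundedBilinearMap_apply.continuous

theorem greenSum_succ [CompleteSpace E] {C : ℤ → E →L[ℝ] E} (hα : 0 < α)
    (hG : ∀ n m : ℤ, ‖G n m‖ ≤ K * Real.exp (-α * |(n : ℝ) - m|))
    (hh : ∀ m, ‖h m‖ ≤ H)
    (hC : ∀ n m, G (n + 1) m = C n * G n m + if m = n + 1 then 1 else 0) (k : ℤ) :
    greenSum G h (k + 1) = C k (greenSum G h k) + h k := by
  have hre : ∀ n, HasSum (fun m => G n m (h (m - 1))) (greenSum G h n) := by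
    intro n
    have hs : Summable fun j : ℤ => G n (n + j) (h (n + j - 1)) :=
      Summable.of_norm_bounded (((summable_exp_neg_mul_abs_int hα).mul_left K).mul_right H)
        (norm_green_apply_le hG hh n)
    exact (Equiv.hasSum_iff (Equiv.addLeft n)
      (f := fun m => G n m (h (m - 1)))).1 hs.hasSum
  refine (hre (k + 1)).unique ?_
  have h1 := ((C k).hasSum (hre k)).add (hasSum_ite_eq (k + 1) (h k))
  refine h1.congr_fun ?_
  intro m
  rw [hC]
  by_cases hm : m = k + 1
  · simp [hm]
  · simp [hm]

end Discrete

section Dichotomy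

variable {p : ℕ} {C Y : ℤ → Matrix (Fin p) (Fin p) ℂ} {P : Matrix (Fin p) (Fin p) ℂ} {α K : ℝ}

theorem green_succ (hY : IsDiscreteFundamentalMatrix C Y) (n m : ℤ) :
    green Y P (n + 1) m = C n * green Y P n m + if m = n + 1 then 1 else 0 := by
  have hdet : Y (n + 1) * (Y (n + 1))⁻¹ = 1 :=
    Matrix.mul_nonsing_inv _ ((Matrix.isUnit_iff_isUnit_det _).1 (hY.2 _))
  rcases lt_trichotomy m (n + 1) with h | h | h
  · rw [green, green, if_pos h.le, if_pos (by omega), if_neg h.ne, hY.1, add_zero]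
    simp only [Matrix.mul_assoc]
  · subst h
    rw [green, green, if_pos le_rfl, if_neg (by omega), if_pos rfl, mul_neg]
    have : C n * (Y n * (1 - P) * (Y (n + 1))⁻¹) = Y (n + 1) * (1 - P) * (Y (n + 1))⁻¹ := by
      rw [hY.1 n]
      simp only [Matrix.mul_assoc]
    rw [this, Matrix.mul_sub, Matrix.sub_mul, Matrix.mul_one, hdet]
    abel
  · rw [green, green, if_neg (by omega), if_neg (by omega), if_neg h.ne', hY.1, add_zero, mul_neg]
    simp only [Matrix.mul_assoc]

/-- Under an exponential dichotomy on `ℤ`, zero is the only bounded solution: its component along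
`P` is controlled from the far past, the complementary one from the far future. -/
theorem eq_zero_of_bounded_of_dichotomy (hα : 0 < α) (hY : IsDiscreteFundamentalMatrix C Y)
    (hG : ∀ n m : ℤ, ‖green Y P n m‖ ≤ K * Real.exp (-α * |(n : ℝ) - (m : ℝ)|))
    {z : ℤ → Fin p → ℂ} (hz : ∀ n, z (n + 1) = (C n).mulVec (z n)) {R : ℝ}
    (hR : ∀ n, ‖z n‖ ≤ R) (n : ℤ) : z n = 0 := by
  have hinv : ∀ m, (Y m)⁻¹ * Y m = 1 := fun m =>
    Matrix.nonsing_inv_mul _ ((Matrix.isUnit_iff_isUnit_det _).1 (hY.2 _))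
  have hinv' : ∀ m, Y m * (Y m)⁻¹ = 1 := fun m =>
    Matrix.mul_nonsing_inv _ ((Matrix.isUnit_iff_isUnit_det _).1 (hY.2 _))
  have hstep : ∀ m, (Y (m + 1))⁻¹.mulVec (z (m + 1)) = (Y m)⁻¹.mulVec (z m) := by
    intro m
    have : z m = (Y m * (Y m)⁻¹).mulVec (z m) := by rw [hinv', Matrix.one_mulVec]
    rw [hz m]
    conv_lhs => rw [this]
    rw [Matrix.mulVec_mulVec, Matrix.mulVec_mulVec, Matrix.mul_assoc, ← Matrix.mul_assoc (C m),
      ← hY.1, ← Matrix.mul_assoc, hinv, Matrix.one_mul]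
  set c := (Y 0)⁻¹.mulVec (z 0) with hc
  -- `z n = Y n *ᵥ c`, so the Green function applied to `z m` gives the components of `z n`.
  have hconst : ∀ m, (Y m)⁻¹.mulVec (z m) = c := by
    intro m
    induction m using Int.induction_on with
    | zero => rfl
    | succ i ih => rw [hstep, ih]
    | pred i ih =>
      rw [← hstep, sub_add_cancel, ih]
  have hbound : ∀ m, ‖(green Y P n m).mulVec (z m)‖ ≤
      K * Real.exp (-α * |(n : ℝ) - (m : ℝ)|) * R := fun m =>
    (Matrix.linfty_opNorm_mulVec _ _).trans
      (mul_le_mul (hG n m) (hR m) (norm_nonneg _) ((norm_nonneg _).trans (hG n m)))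
  have hlim : ∀ σ : ℕ → ℤ, Tendsto (fun i => |(n : ℝ) - (σ i : ℝ)|) atTop atTop →
      Tendsto (fun i => K * Real.exp (-α * |(n : ℝ) - (σ i : ℝ)|) * R) atTop (𝓝 0) := by
    intro σ hσ
    have := Real.tendsto_exp_neg_atTop_nhds_zero.comp (hσ.const_mul_atTop hα)
    simpa [Function.comp_def] using (this.const_mul K).mul_const R
  have h1 : (Y n * P).mulVec c = 0 := by
    refine norm_le_zero_iff.1 (ge_of_tendsto (hlim (fun i => n - i) ?_)
      (Eventually.of_forall fun i => ?_))
    · simpa using tendsto_natCast_atTop_atTop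
    · have := hbound (n - i)
      rwa [green, if_pos (by omega), ← Matrix.mulVec_mulVec, hconst] at this
  have h2 : (Y n * (1 - P)).mulVec c = 0 := by
    refine norm_le_zero_iff.1 (ge_of_tendsto (hlim (fun i => n + (i + 1)) ?_)
      (Eventually.of_forall fun i => ?_))
    · have : ∀ i : ℕ, |(n : ℝ) - ((n + (i + 1) : ℤ) : ℝ)| = (i : ℝ) + 1 := by
        intro i
        push_cast
        rw [sub_add_cancel_left, abs_neg, abs_of_nonneg (by positivity)]
      simp only [this]
      exact tendsto_atTop_add_const_right _ _ tendsto_natCast_atTop_atTop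
    · have := hbound (n + (i + 1))
      rwa [green, if_neg (by omega), Matrix.neg_mulVec, norm_neg, ← Matrix.mulVec_mulVec,
        hconst] at this
  calc z n = (Y n * (Y n)⁻¹).mulVec (z n) := by rw [hinv', Matrix.one_mulVec]
    _ = (Y n * P + Y n * (1 - P)).mulVec c := by
      rw [← Matrix.mulVec_mulVec, hconst, ← Matrix.mul_add, add_sub_cancel, Matrix.mul_one]
    _ = 0 := by rw [Matrix.add_mulVec, h1, h2, add_zero]

end Dichotomy

/-! ### Variation of constants on a unit interval -/

section StepSolution

variable {E : Type*} [NormedAddCommGroup E] [NormedSpace ℝ E]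

/-- The solution of `z' = a z + g` with `z(t₀) = ζ` given by variation of constants, where `Φ` is a
fundamental solution of `z' = a z` with pointwise inverse `Ψ`. -/
noncomputable def stepSol (Φ Ψ : ℝ → E →L[ℝ] E) (t₀ : ℝ) (ζ : E) (g : ℝ → E) (t : ℝ) : E :=
  Φ t (Ψ t₀ ζ + ∫ u in t₀..t, Ψ u (g u))

/-- `Φ` is a fundamental solution of `z' = a z` with pointwise inverse `Ψ`. -/
structure IsFundamentalPair (a Φ Ψ : ℝ → E →L[ℝ] E) : Prop where
  deriv : ∀ t, HasDerivAt Φ (a t * Φ t) t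
  cont_inv : Continuous Ψ
  mul_inv : ∀ t, Φ t * Ψ t = 1

variable {a Φ Ψ : ℝ → E →L[ℝ] E} {g : ℝ → E} {M N : ℝ}

theorem IsFundamentalPair.apply_inv (h : IsFundamentalPair a Φ Ψ) (t : ℝ) (x : E) :
    Φ t (Ψ t x) = x :=
  congrArg (fun T : E →L[ℝ] E => T x) (h.mul_inv t)

theorem stepSol_self (h : IsFundamentalPair a Φ Ψ) (t₀ : ℝ) (ζ : E) :
    stepSol Φ Ψ t₀ ζ g t₀ = ζ := by
  simp [stepSol, h.apply_inv]

theorem hasDerivAt_stepSol [CompleteSpace E] (h : IsFundamentalPair a Φ Ψ) (hg : Continuous g)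
    (t₀ : ℝ) (ζ : E) (t : ℝ) :
    HasDerivAt (stepSol Φ Ψ t₀ ζ g) (a t (stepSol Φ Ψ t₀ ζ g t) + g t) t := by
  have hc : Continuous fun u => Ψ u (g u) := h.cont_inv.clm_apply hg
  have h1 : HasDerivAt (fun t => Ψ t₀ ζ + ∫ u in t₀..t, Ψ u (g u)) (Ψ t (g t)) t :=
    (hc.integral_hasStrictDerivAt t₀ t).hasDerivAt.const_add _
  have h2 := (h.deriv t).clm_apply h1
  rwa [h.apply_inv] at h2

theorem isMild_of_hasDerivAt [CompleteSpace E] {z : ℝ → E} (ha : Continuous a)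
    (hg : Continuous g) (hz : ∀ t, HasDerivAt z (a t (z t) + g t) t) (m : ℝ) :
    IsMild (fun τ => a (m + τ)) (fun τ => g (m + τ)) (z m) (fun τ => z (m + τ)) := by
  have hzc : Continuous z := continuous_iff_continuousAt.2 fun t => (hz t).continuousAt
  refine ⟨by fun_prop, fun t _ => ?_⟩
  have hc : Continuous fun u => a u (z u) + g u := (ha.clm_apply hzc).add hg
  rw [intervalIntegral.integral_comp_add_left (fun u => a u (z u) + g u) m,
    intervalIntegral.integral_eq_sub_of_hasDerivAt (fun u _ => hz u)
      (hc.intervalIntegrable _ _)]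
  simp

theorem IsMild.congr_right {ζ : E} {z g' : ℝ → E} (hz : IsMild a g ζ z)
    (h : EqOn g g' (Ico 0 1)) : IsMild a g' ζ z := by
  refine ⟨hz.cont, fun t ht => ?_⟩
  rw [hz.eq t ht]
  congr 1
  refine intervalIntegral.integral_congr_ae ?_
  -- The endpoint `1`, where `g` and `g'` may differ, is a null set.
  have h1 : ∀ᵐ u : ℝ, u ≠ 1 := by simp [ae_iff, measure_singleton]
  filter_upwards [h1] with u hu hut
  rw [uIoc_of_le ht.1] at hut
  rw [h ⟨hut.1.le, lt_of_le_of_ne (hut.2.trans ht.2) hu⟩]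

/-- Uniqueness for the initial value problem among functions that are merely right differentiable. -/
theorem eqOn_stepSol [CompleteSpace E] (h : IsFundamentalPair a Φ Ψ) (hM : ∀ t, ‖a t‖ ≤ M)
    (hg : Continuous g) {w : ℝ → E} {t₀ t₁ : ℝ} (hw : ContinuousOn w (Icc t₀ t₁))
    (hw' : ∀ t ∈ Ico t₀ t₁, HasDerivWithinAt w (a t (w t) + g t) (Ici t) t) :
    EqOn w (stepSol Φ Ψ t₀ (w t₀) g) (Icc t₀ t₁) := by
  have hz := hasDerivAt_stepSol h hg t₀ (w t₀)
  intro t ht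
  refine sub_eq_zero.1 (eq_zero_of_abs_deriv_le_mul_abs_self_of_eq_zero_right (K := M)
    (f := fun t => w t - stepSol Φ Ψ t₀ (w t₀) g t)
    (hw.sub fun t _ => (hz t).continuousAt.continuousWithinAt)
    (fun t ht => (hw' t ht).sub (hz t).hasDerivWithinAt)
    (by rw [stepSol_self h, sub_self]) (fun t _ => ?_) t ht)
  rw [add_sub_add_right_eq_sub, ← map_sub]
  exact ((a t).le_opNorm _).trans (mul_le_mul_of_nonneg_right (hM t) (norm_nonneg _))

theorem stepSol_add [CompleteSpace E] (h : IsFundamentalPair a Φ Ψ) {g' : ℝ → E}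
    (hg : Continuous g) (hg' : Continuous g') (t₀ : ℝ) (ζ ζ' : E) (t : ℝ) :
    stepSol Φ Ψ t₀ (ζ + ζ') (fun u => g u + g' u) t =
      stepSol Φ Ψ t₀ ζ g t + stepSol Φ Ψ t₀ ζ' g' t := by
  have h1 := (h.cont_inv.clm_apply hg).intervalIntegrable (μ := volume) t₀ t
  have h2 := (h.cont_inv.clm_apply hg').intervalIntegrable (μ := volume) t₀ t
  simp only [stepSol, map_add]
  rw [intervalIntegral.integral_add h1 h2]
  simp only [map_add]
  abel

end StepSolution

/-! ### Matrices as operators -/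

section Matrices

variable {p : ℕ}

/-- The action of matrices on vectors, as an isometry into the real-linear operators. -/
noncomputable def matOp (p : ℕ) :
    Matrix (Fin p) (Fin p) ℂ →ₗᵢ[ℝ] ((Fin p → ℂ) →L[ℝ] (Fin p → ℂ)) where
  toFun A := ContinuousLinearMap.restrictScalars ℝ ⟨A.mulVecLin, by fun_prop⟩
  map_add' A B := by ext1 v; exact Matrix.add_mulVec A B v
  map_smul' c A := by ext1 v; exact Matrix.smul_mulVec c A v
  norm_map' A := by
    refine Eq.trans ?_ (Matrix.linfty_opNorm_eq_opNorm A).symm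
    exact ContinuousLinearMap.norm_restrictScalars _

@[simp]
theorem matOp_apply (A : Matrix (Fin p) (Fin p) ℂ) (v : Fin p → ℂ) :
    matOp p A v = A.mulVec v := rfl

theorem matOp_mul (A B : Matrix (Fin p) (Fin p) ℂ) : matOp p (A * B) = matOp p A * matOp p B := by
  ext1 v
  simp [Matrix.mulVec_mulVec]

theorem matOp_one : matOp p 1 = 1 := by
  ext1 v
  simp

theorem matOp_mul_inv {A : Matrix (Fin p) (Fin p) ℂ} (h : IsUnit A) :
    matOp p A * matOp p A⁻¹ = 1 := by
  rw [← matOp_mul, Matrix.mul_nonsing_inv _ ((Matrix.isUnit_iff_isUnit_det _).1 h), matOp_one]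

theorem matOp_inv_mul {A : Matrix (Fin p) (Fin p) ℂ} (h : IsUnit A) :
    matOp p A⁻¹ * matOp p A = 1 := by
  rw [← matOp_mul, Matrix.nonsing_inv_mul _ ((Matrix.isUnit_iff_isUnit_det _).1 h), matOp_one]

theorem IsFundamentalMatrix.isFundamentalPair {A Φ : ℝ → Matrix (Fin p) (Fin p) ℂ}
    (h : IsFundamentalMatrix A Φ) :
    IsFundamentalPair (fun t => matOp p (A t)) (fun t => matOp p (Φ t))
      (fun t => matOp p (Φ t)⁻¹) := by
  have hd : ∀ t, HasDerivAt (fun t => matOp p (Φ t)) (matOp p (A t) * matOp p (Φ t)) t := by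
    intro t
    rw [← matOp_mul]
    exact (matOp p).toContinuousLinearMap.hasFDerivAt.comp_hasDerivAt t (h.1 t)
  refine ⟨hd, ?_, fun t => matOp_mul_inv (h.2 t)⟩
  refine continuous_iff_continuousAt.2 fun t => ?_
  let U : ℝ → ((Fin p → ℂ) →L[ℝ] (Fin p → ℂ))ˣ := fun t =>
    ⟨matOp p (Φ t), matOp p (Φ t)⁻¹, matOp_mul_inv (h.2 t), matOp_inv_mul (h.2 t)⟩
  have hU : (fun t => matOp p (Φ t)⁻¹) = fun t => Ring.inverse (matOp p (Φ t)) := by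
    funext t
    exact (Ring.inverse_unit (U t)).symm
  rw [hU]
  exact ContinuousAt.comp (f := fun t => matOp p (Φ t)) (g := Ring.inverse) (x := t)
    (NormedRing.inverse_continuousAt (U t)) (hd t).continuousAt

/-- The coefficient `C(n)` maps the value at `n` of a solution of `z' = A z + B z(n)` to its value
at `n + 1`. -/
theorem coeffC_mulVec {A B Φ : ℝ → Matrix (Fin p) (Fin p) ℂ}
    (hΦ : IsFundamentalMatrix A Φ) (hB : Continuous fun t => matOp p (B t)) (n : ℤ)
    (x : Fin p → ℂ) :
    (coeffC B Φ n).mulVec x = stepSol (fun t => matOp p (Φ t)) (fun t => matOp p (Φ t)⁻¹) n x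
      (fun u => matOp p (B u) x) (n + 1) := by
  have hpair := hΦ.isFundamentalPair
  have hc : Continuous fun u : ℝ => matOp p (transition Φ (n + 1) u * B u) := by
    simp only [transition, matOp_mul]
    exact (continuous_const.mul hpair.cont_inv).mul hB
  have hI : matOp p (∫ u in (n : ℝ)..((n : ℝ) + 1), transition Φ ((n : ℝ) + 1) u * B u) =
      ∫ u in (n : ℝ)..((n : ℝ) + 1), matOp p (transition Φ ((n : ℝ) + 1) u * B u) := by
    have : CompleteSpace (Matrix (Fin p) (Fin p) ℂ) := FiniteDimensional.complete ℝ _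
    rw [intervalIntegral.integral_of_le (by simp), intervalIntegral.integral_of_le (by simp)]
    exact ((matOp p).integral_comp_comm _).symm
  rw [← matOp_apply, coeffC, map_add, hI, add_apply,
    ContinuousLinearMap.intervalIntegral_apply (hc.intervalIntegrable _ _), stepSol, map_add,
    ← ContinuousLinearMap.intervalIntegral_comp_comm _
      ((hpair.cont_inv.clm_apply (hB.clm_apply continuous_const)).intervalIntegrable _ _)]
  simp [transition, Matrix.mulVec_mulVec, Matrix.mul_assoc]

end Matrices

/-! ### Piecewise continuous functions -/

section Piecewise

theorem IsPCZ.exists_continuous {X : Type*} [NormedAddCommGroup X] {f : ℝ → X} (hf : IsPCZ f)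
    (n : ℤ) : ∃ c : ℝ → X, Continuous c ∧ EqOn f c (Ico (n : ℝ) (n + 1)) := by
  have hlt : (n : ℝ) < n + 1 := lt_add_one _
  obtain ⟨l, hl⟩ := hf.2 (n + 1)
  push_cast at hl
  have hn := (hf.1 n n ⟨le_rfl, hlt⟩)
  have hr : Tendsto f (𝓝[>] (n : ℝ)) (𝓝 (f n)) :=
    hn.mono_of_mem_nhdsWithin (mem_of_superset (Ioo_mem_nhdsGT hlt) Ioo_subset_Ico_self)
  have hoo : ContinuousOn f (Ioo (n : ℝ) (n + 1)) := (hf.1 n).mono Ioo_subset_Ico_self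
  have hc := continuousOn_Icc_extendFrom_Ioo hoo hr hl
  refine ⟨IccExtend hlt.le ((Icc (n : ℝ) (n + 1)).domRestrict (extendFrom (Ioo (n : ℝ) (n + 1)) f)),
    (continuousOn_iff_continuous_domRestrict.1 hc).Icc_extend', fun t ht => ?_⟩
  rw [IccExtend_of_mem _ _ ⟨ht.1, ht.2.le⟩]
  show f t = extendFrom (Ioo (n : ℝ) (n + 1)) f t
  rcases ht.1.eq_or_lt with h | h
  · rw [← h, eq_lim_at_left_extendFrom_Ioo hlt hr]
  · rw [extendFrom_extends hoo t ⟨h, ht.2⟩]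

theorem IsPCZ.measurable {X : Type*} [NormedAddCommGroup X] [MeasurableSpace X] [BorelSpace X]
    {f : ℝ → X} (hf : IsPCZ f) : Measurable f := by
  choose c hc hfc using hf.exists_continuous
  have h1 : Measurable fun q : ℤ × ℝ => c q.1 q.2 :=
    measurable_from_prod_countable_right fun n => (hc n).measurable
  have h2 : f = fun t => c ⌊t⌋ t :=
    funext fun t => hfc ⌊t⌋ ⟨Int.floor_le t, Int.lt_floor_add_one t⟩
  rw [h2]
  exact h1.comp (Int.measurable_floor.prodMk measurable_id)

/-- Gluing functions on `[n, n + 1]` which agree at the integers. -/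
theorem continuous_of_continuousOn_Icc_int {X : Type*} [TopologicalSpace X] {y : ℝ → X}
    (h : ∀ n : ℤ, ContinuousOn y (Icc (n : ℝ) (n + 1))) : Continuous y := by
  refine continuous_iff_continuousAt.2 fun t => continuousAt_iff_continuous_left_right.2 ⟨?_, ?_⟩
  · have h1 : ((⌈t⌉ - 1 : ℤ) : ℝ) < t := by
      have := Int.ceil_lt_add_one t
      push_cast
      linarith
    have h2 : t ≤ ((⌈t⌉ - 1 : ℤ) : ℝ) + 1 := by
      push_cast
      linarith [Int.le_ceil t]
    refine (h (⌈t⌉ - 1) t ⟨h1.le, h2⟩).mono_of_mem_nhdsWithin ?_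
    exact mem_of_superset (Ioc_mem_nhdsLE h1) fun u hu => ⟨hu.1.le, hu.2.trans h2⟩
  · have h1 := Int.lt_floor_add_one t
    refine (h ⌊t⌋ t ⟨Int.floor_le t, h1.le⟩).mono_of_mem_nhdsWithin ?_
    exact mem_of_superset (Ico_mem_nhdsGE h1) fun u hu => ⟨(Int.floor_le t).trans hu.1, hu.2.le⟩

end Piecewise

/-! ### Almost automorphy in terms of two-sided limits -/

section Bridge

variable {X : Type*} [NormedAddCommGroup X]

theorem IsAlmostAutomorphic.exists_norm_le {f : ℝ → X} (hf : IsAlmostAutomorphic f) :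
    ∃ M : ℝ, ∀ t, ‖f t‖ ≤ M :=
  exists_norm_le_of_subseq_tendsto fun s => by
    obtain ⟨φ, hφ, f', h, -⟩ := hf.2 s
    exact ⟨φ, hφ, f' 0, by simpa using h 0⟩

theorem IsCompactAlmostAutomorphic.exists_norm_le {f : ℝ → X}
    (hf : IsCompactAlmostAutomorphic f) : ∃ M : ℝ, ∀ t, ‖f t‖ ≤ M :=
  exists_norm_le_of_subseq_tendsto fun s => by
    obtain ⟨φ, hφ, f', h⟩ := hf.2 s
    exact ⟨φ, hφ, f' 0, by simpa using (h {0} isCompact_singleton).1.tendsto_at (mem_singleton 0)⟩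

theorem shiftLimit_of_tendsto {f f' : ℝ → X} {s : ℕ → ℤ}
    (h : ∀ t : ℝ, Tendsto (fun n => f (t + (s n : ℝ))) atTop (𝓝 (f' t)))
    (h' : ∀ t : ℝ, Tendsto (fun n => f' (t - (s n : ℝ))) atTop (𝓝 (f t))) :
    ShiftLimit s (fun m τ => f ((m : ℝ) + τ)) (fun m τ => f' ((m : ℝ) + τ)) := by
  refine ⟨fun m => tendsto_pi_nhds.2 fun τ => ?_, fun m => tendsto_pi_nhds.2 fun τ => ?_⟩
  · refine (h (m + τ)).congr fun n => ?_
    push_cast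
    congr 1
    ring
  · refine (h' (m + τ)).congr fun n => ?_
    push_cast
    congr 1
    ring

theorem IsAlmostAutomorphic.exists_shiftLimit {f : ℝ → X} (hf : IsAlmostAutomorphic f)
    (s : ℕ → ℤ) : ∃ φ : ℕ → ℕ, StrictMono φ ∧ ∃ f' : ℤ → ℝ → X,
      ShiftLimit (s ∘ φ) (fun m τ => f ((m : ℝ) + τ)) f' := by
  obtain ⟨φ, hφ, f', h, h'⟩ := hf.2 fun n => (s n : ℝ)
  exact ⟨φ, hφ, _, shiftLimit_of_tendsto h h'⟩

theorem IsZAlmostAutomorphic.exists_shiftLimit {f : ℝ → X} (hf : IsZAlmostAutomorphic f)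
    (s : ℕ → ℤ) : ∃ φ : ℕ → ℕ, StrictMono φ ∧ ∃ f' : ℤ → ℝ → X,
      ShiftLimit (s ∘ φ) (fun m τ => f ((m : ℝ) + τ)) f' := by
  obtain ⟨φ, hφ, f', h, h'⟩ := hf.2 s
  exact ⟨φ, hφ, _, shiftLimit_of_tendsto h h'⟩

theorem IsBiAlmostAutomorphic.exists_shiftLimit {G : ℤ → ℤ → X} (hG : IsBiAlmostAutomorphic G)
    (s : ℕ → ℤ) : ∃ φ : ℕ → ℕ, StrictMono φ ∧ ∃ G' : ℤ → ℤ → X,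
      ∀ j, ShiftLimit (s ∘ φ) (fun k => G k (k + j)) (fun k => G' k (k + j)) := by
  obtain ⟨φ, hφ, G', h, h'⟩ := hG s
  refine ⟨φ, hφ, G', fun j => ⟨fun m => ?_, fun m => ?_⟩⟩
  · refine (h m (m + j)).congr fun n => ?_
    simp only [Function.comp]
    congr 1
    ring
  · refine (h' m (m + j)).congr fun n => ?_
    simp only [Function.comp]
    congr 1
    ring

end Bridge

/-! ### Gluing the pieces of a solution -/

section Glue

variable {E : Type*} [NormedAddCommGroup E] [NormedSpace ℝ E]
  {a b Φ Ψ : ℝ → E →L[ℝ] E} {c : ℤ → ℝ → E} {x : ℤ → E}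

/-- The function equal on `[n, n + 1)` to the solution of `z' = a z + b x(n) + c(n, ·)` with value
`x n` at `n`. Here `c n` stands for a continuous extension of the forcing term from `[n, n + 1)`. -/
noncomputable def glued (b Φ Ψ : ℝ → E →L[ℝ] E) (c : ℤ → ℝ → E) (x : ℤ → E) (t : ℝ) : E :=
  stepSol Φ Ψ (⌊t⌋ : ℝ) (x ⌊t⌋) (fun u => b u (x ⌊t⌋) + c ⌊t⌋ u) t

theorem glued_intCast (h : IsFundamentalPair a Φ Ψ) (n : ℤ) : glued b Φ Ψ c x n = x n := by
  simp only [glued, Int.floor_intCast]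
  exact stepSol_self h _ _

theorem eqOn_glued (h : IsFundamentalPair a Φ Ψ)
    (hx : ∀ n : ℤ, x (n + 1) =
      stepSol Φ Ψ (n : ℝ) (x n) (fun u => b u (x n) + c n u) ((n : ℝ) + 1)) (n : ℤ) :
    EqOn (glued b Φ Ψ c x) (stepSol Φ Ψ (n : ℝ) (x n) (fun u => b u (x n) + c n u))
      (Icc (n : ℝ) (n + 1)) := by
  intro t ht
  rcases ht.2.eq_or_lt with h1 | h1
  · subst h1
    rw [← hx, ← glued_intCast (b := b) (c := c) (x := x) h (n + 1)]
    push_cast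
    rfl
  · rw [glued, Int.floor_eq_iff.2 ⟨ht.1, h1⟩]

theorem continuous_glued [CompleteSpace E] (h : IsFundamentalPair a Φ Ψ) (hb : Continuous b)
    (hc : ∀ n, Continuous (c n))
    (hx : ∀ n : ℤ, x (n + 1) =
      stepSol Φ Ψ (n : ℝ) (x n) (fun u => b u (x n) + c n u) ((n : ℝ) + 1)) :
    Continuous (glued b Φ Ψ c x) := by
  refine continuous_of_continuousOn_Icc_int fun n => ContinuousOn.congr ?_ (eqOn_glued h hx n)
  have hg : Continuous fun u => b u (x n) + c n u := (hb.clm_apply continuous_const).add (hc n)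
  exact fun t _ => (hasDerivAt_stepSol h hg n (x n) t).continuousAt.continuousWithinAt

theorem hasDerivAt_glued [CompleteSpace E] (h : IsFundamentalPair a Φ Ψ) (hb : Continuous b)
    (hc : ∀ n, Continuous (c n))
    (hx : ∀ n : ℤ, x (n + 1) =
      stepSol Φ Ψ (n : ℝ) (x n) (fun u => b u (x n) + c n u) ((n : ℝ) + 1))
    {n : ℤ} {t : ℝ} (ht : t ∈ Ioo (n : ℝ) (n + 1)) :
    HasDerivAt (glued b Φ Ψ c x)
      (a t (glued b Φ Ψ c x t) + (b t (glued b Φ Ψ c x n) + c n t)) t := by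
  have hg : Continuous fun u => b u (x n) + c n u := (hb.clm_apply continuous_const).add (hc n)
  rw [glued_intCast h, eqOn_glued h hx n (Ioo_subset_Icc_self ht)]
  exact (hasDerivAt_stepSol h hg n (x n) t).congr_of_eventuallyEq
    (((eqOn_glued h hx n).mono Ioo_subset_Icc_self).eventuallyEq_of_mem (isOpen_Ioo.mem_nhds ht))

theorem hasDerivWithinAt_glued [CompleteSpace E] (h : IsFundamentalPair a Φ Ψ)
    (hb : Continuous b) (hc : ∀ n, Continuous (c n))
    (hx : ∀ n : ℤ, x (n + 1) =
      stepSol Φ Ψ (n : ℝ) (x n) (fun u => b u (x n) + c n u) ((n : ℝ) + 1)) (n : ℤ) :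
    HasDerivWithinAt (glued b Φ Ψ c x)
      (a n (glued b Φ Ψ c x n) + (b n (glued b Φ Ψ c x n) + c n n)) (Ici (n : ℝ)) n := by
  have hg : Continuous fun u => b u (x n) + c n u := (hb.clm_apply continuous_const).add (hc n)
  have hmem : (n : ℝ) ∈ Icc (n : ℝ) (n + 1) := ⟨le_rfl, (lt_add_one _).le⟩
  have h1 := (hasDerivAt_stepSol h hg n (x n) n).hasDerivWithinAt (s := Ici (n : ℝ))
  rw [stepSol_self h] at h1
  rw [glued_intCast h]
  exact h1.congr_of_eventuallyEq ((eqOn_glued h hx n).eventuallyEq_of_mem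
    (mem_of_superset (Ico_mem_nhdsGE (lt_add_one _)) Ico_subset_Icc_self))
    (eqOn_glued h hx n hmem)

end Glue

/-! ### Solutions of the equation with piecewise constant argument -/

section Solutions

variable {p : ℕ} {A B : ℝ → Matrix (Fin p) (Fin p) ℂ} {f y y₁ y₂ : ℝ → Fin p → ℂ}

theorem linearRHS_eq (t : ℝ) : linearRHS A B f y t =
    matOp p (A t) (y t) + (matOp p (B t) (y (⌊t⌋ : ℝ)) + f t) :=
  add_assoc _ _ _

theorem IsSolution.hasDerivWithinAt (hy : IsSolution A B f y) (t : ℝ) :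
    HasDerivWithinAt y (linearRHS A B f y t) (Ici t) t := by
  rcases (Int.floor_le t).eq_or_lt with h | h
  · have := hy.2.2 ⌊t⌋
    rwa [h] at this
  · exact (hy.2.1 ⌊t⌋ t ⟨h, Int.lt_floor_add_one t⟩).hasDerivWithinAt

/-- A bounded solution is Lipschitz, because its right derivative is bounded. -/
theorem IsSolution.exists_lipschitzWith (hy : IsSolution A B f y) {MA MB Mf R : ℝ}
    (hA : ∀ t, ‖A t‖ ≤ MA) (hB : ∀ t, ‖B t‖ ≤ MB) (hf : ∀ t, ‖f t‖ ≤ Mf)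
    (hR : ∀ t, ‖y t‖ ≤ R) : ∃ L, LipschitzWith L y := by
  have hbound : ∀ t, ‖linearRHS A B f y t‖ ≤ MA * R + MB * R + Mf := fun t =>
    (norm_add_le _ _).trans (add_le_add ((norm_add_le _ _).trans (add_le_add
      ((Matrix.linfty_opNorm_mulVec _ _).trans
        (mul_le_mul (hA t) (hR t) (norm_nonneg _) ((norm_nonneg _).trans (hA t))))
      ((Matrix.linfty_opNorm_mulVec _ _).trans
        (mul_le_mul (hB t) (hR _) (norm_nonneg _) ((norm_nonneg _).trans (hB t))))))
      (hf t))
  have hL0 : 0 ≤ MA * R + MB * R + Mf := (norm_nonneg _).trans (hbound 0)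
  have key : ∀ u v : ℝ, u ≤ v → ‖y v - y u‖ ≤ (MA * R + MB * R + Mf) * (v - u) := fun u v huv =>
    norm_image_sub_le_of_norm_deriv_right_le_segment hy.1.continuousOn
      (fun t _ => hy.hasDerivWithinAt t) (fun t _ => hbound t) v ⟨huv, le_rfl⟩
  refine ⟨NNReal.mk _ hL0, LipschitzWith.of_dist_le_mul fun u v => ?_⟩
  rw [NNReal.coe_mk, Real.dist_eq, dist_eq_norm]
  rcases le_total u v with h | h
  · rw [norm_sub_rev, abs_sub_comm, abs_of_nonneg (sub_nonneg.2 h)]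
    exact key u v h
  · rw [abs_of_nonneg (sub_nonneg.2 h)]
    exact key v u h

/-- Two bounded solutions coincide: the values at the integers of their difference form a bounded
solution of the homogeneous difference equation, hence vanish. -/
theorem IsSolution.eq_of_bounded {Φ : ℝ → Matrix (Fin p) (Fin p) ℂ}
    {Y : ℤ → Matrix (Fin p) (Fin p) ℂ} {P : Matrix (Fin p) (Fin p) ℂ} {α K MA R₁ R₂ : ℝ}
    (hA : ∀ t, ‖A t‖ ≤ MA) (hB : Continuous fun t => matOp p (B t))
    (hΦ : IsFundamentalMatrix A Φ) (hα : 0 < α)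
    (hY : IsDiscreteFundamentalMatrix (coeffC B Φ) Y)
    (hG : ∀ n m : ℤ, ‖green Y P n m‖ ≤ K * Real.exp (-α * |(n : ℝ) - (m : ℝ)|))
    (hy₁ : IsSolution A B f y₁) (hy₂ : IsSolution A B f y₂)
    (hR₁ : ∀ t, ‖y₁ t‖ ≤ R₁) (hR₂ : ∀ t, ‖y₂ t‖ ≤ R₂) : y₁ = y₂ := by
  have hpair := hΦ.isFundamentalPair
  set w : ℝ → Fin p → ℂ := fun t => y₁ t - y₂ t with hw
  have hstep : ∀ n : ℤ, EqOn w (stepSol (fun t => matOp p (Φ t)) (fun t => matOp p (Φ t)⁻¹)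
      (n : ℝ) (w n) (fun u => matOp p (B u) (w n))) (Icc (n : ℝ) (n + 1)) := by
    intro n
    refine eqOn_stepSol (M := MA) hpair (fun t => (LinearIsometry.norm_map _ _).trans_le (hA t))
      (hB.clm_apply continuous_const) (hy₁.1.sub hy₂.1).continuousOn fun t ht => ?_
    refine ((hy₁.hasDerivWithinAt t).sub (hy₂.hasDerivWithinAt t)).congr_deriv ?_
    rw [linearRHS_eq, linearRHS_eq, Int.floor_eq_iff.2 ⟨ht.1, ht.2⟩]
    simp only [hw, map_sub]
    abel
  have hint : ∀ n : ℤ, w n = 0 := by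
    refine eq_zero_of_bounded_of_dichotomy hα hY hG (z := fun n : ℤ => w n) (fun n => ?_)
      (R := R₁ + R₂) (fun n => (norm_sub_le _ _).trans (add_le_add (hR₁ _) (hR₂ _)))
    rw [coeffC_mulVec hΦ hB]
    push_cast
    exact hstep n ⟨(lt_add_one _).le, le_rfl⟩
  funext t
  refine sub_eq_zero.1 ?_
  have := hstep ⌊t⌋ ⟨Int.floor_le t, (Int.lt_floor_add_one t).le⟩
  rw [hint] at this
  simpa [stepSol] using this

end Solutions

/-! ### The bounded solution and its translates -/

section BoundedSolution

variable {E : Type*} [NormedAddCommGroup E] [NormedSpace ℝ E]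
  {a b Φ Ψ : ℝ → E →L[ℝ] E} {f : ℝ → E} {c : ℤ → ℝ → E} {M N R : ℝ} {s : ℕ → ℤ}

theorem isBddMeasurable_apply_add {MB : ℝ} (hb : IsBddMeasurable MB b) (hf : IsBddMeasurable N f)
    {v : E} (hv : ‖v‖ ≤ R) (m : ℝ) :
    IsBddMeasurable (MB * R + N) (fun τ => b (m + τ) v + f (m + τ)) := by
  refine ⟨?_, fun t => (norm_add_le _ _).trans (add_le_add (((b _).le_opNorm _).trans
    (mul_le_mul (hb.2 _) hv (norm_nonneg _) hb.nonneg)) (hf.2 _))⟩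
  exact ((ContinuousLinearMap.apply ℝ E v).continuous.comp_stronglyMeasurable
    (hb.comp_const_add m).1).add (hf.comp_const_add m).1

variable [CompleteSpace E]

theorem isMild_stepSol (h : IsFundamentalPair a Φ Ψ) (ha : Continuous a) {g g' : ℝ → E}
    (hg : Continuous g) {m : ℤ} (hgg' : EqOn g' g (Ico (m : ℝ) (m + 1))) (ζ : E) :
    IsMild (fun τ => a (m + τ)) (fun τ => g' (m + τ)) ζ
      (fun τ => stepSol Φ Ψ m ζ g (m + τ)) := by
  have h1 := isMild_of_hasDerivAt ha hg (hasDerivAt_stepSol h hg m ζ) m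
  rw [stepSol_self h] at h1
  exact h1.congr_right fun τ hτ => (hgg' ⟨by linarith [hτ.1], by linarith [hτ.2]⟩).symm

/-- The contribution of the forcing term over `[m, m + 1]`, i.e. the inhomogeneity of the
difference equation satisfied by the values at the integers. -/
noncomputable def forcing (Φ Ψ : ℝ → E →L[ℝ] E) (c : ℤ → ℝ → E) (m : ℤ) : E :=
  stepSol Φ Ψ (m : ℝ) 0 (c m) ((m : ℝ) + 1)

theorem norm_forcing_le (h : IsFundamentalPair a Φ Ψ) (ha : Continuous a)
    (haM : IsBddMeasurable M a) (hf : IsBddMeasurable N f) (hc : ∀ n, Continuous (c n))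
    (hfc : ∀ n : ℤ, EqOn f (c n) (Ico (n : ℝ) (n + 1))) (m : ℤ) :
    ‖forcing Φ Ψ c m‖ ≤ (0 + N) * Real.exp M :=
  (isMild_stepSol h ha (hc m) (hfc m) 0).norm_le (haM.comp_const_add m) (hf.comp_const_add m)
    norm_zero.le 1 ⟨zero_le_one, le_rfl⟩

theorem exists_shiftLimit_forcing (h : IsFundamentalPair a Φ Ψ) (ha : Continuous a)
    (haM : IsBddMeasurable M a) (hf : IsBddMeasurable N f) (hc : ∀ n, Continuous (c n))
    (hfc : ∀ n : ℤ, EqOn f (c n) (Ico (n : ℝ) (n + 1)))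
    {a' : ℤ → ℝ → E →L[ℝ] E} {f' : ℤ → ℝ → E}
    (hal : ShiftLimit s (fun (m : ℤ) (τ : ℝ) => a (m + τ)) a')
    (hfl : ShiftLimit s (fun (m : ℤ) (τ : ℝ) => f (m + τ)) f') :
    ∃ h', ShiftLimit s (forcing Φ Ψ c) h' := by
  obtain ⟨z', hz'⟩ := IsMild.exists_shiftLimit (fun m => haM.comp_const_add (m : ℝ))
    (fun m => hf.comp_const_add (m : ℝ))
    (fun m : ℤ => isMild_stepSol h ha (hc m) (hfc m) 0) hal hfl
    (ζ' := fun _ => 0) ⟨fun _ => tendsto_const_nhds, fun _ => tendsto_const_nhds⟩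
  exact ⟨_, hz' 1 ⟨zero_le_one, le_rfl⟩⟩

theorem isMild_glued (h : IsFundamentalPair a Φ Ψ) (ha : Continuous a) (hb : Continuous b)
    (hc : ∀ n, Continuous (c n)) (hfc : ∀ n : ℤ, EqOn f (c n) (Ico (n : ℝ) (n + 1))) {x : ℤ → E}
    (hx : ∀ n : ℤ, x (n + 1) =
      stepSol Φ Ψ (n : ℝ) (x n) (fun u => b u (x n) + c n u) ((n : ℝ) + 1)) (m : ℤ) :
    IsMild (fun τ => a (m + τ)) (fun τ => b (m + τ) (x m) + f (m + τ)) (x m)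
      (fun τ => glued b Φ Ψ c x (m + τ)) := by
  have hg : Continuous fun u => b u (x m) + c m u := (hb.clm_apply continuous_const).add (hc m)
  have h1 := isMild_stepSol (m := m) h ha (g' := fun u => b u (x m) + f u) hg
    (fun u hu => by simp only [hfc m hu]) (x m)
  have h2 : EqOn (fun τ => glued b Φ Ψ c x (m + τ))
      (fun τ => stepSol Φ Ψ m (x m) (fun u => b u (x m) + c m u) (m + τ)) (Icc 0 1) :=
    fun τ hτ => eqOn_glued h hx m ⟨by linarith [hτ.1], by linarith [hτ.2]⟩
  refine ⟨h1.cont.congr h2, fun t ht => ?_⟩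
  simp only [h2 ht]
  rw [h1.eq t ht]
  congr 1
  refine intervalIntegral.integral_congr fun u hu => ?_
  rw [uIcc_of_le ht.1] at hu
  simp only [h2 ⟨hu.1, hu.2.trans ht.2⟩]

theorem norm_glued_le (h : IsFundamentalPair a Φ Ψ) (ha : Continuous a) (hb : Continuous b)
    (hc : ∀ n, Continuous (c n)) (hfc : ∀ n : ℤ, EqOn f (c n) (Ico (n : ℝ) (n + 1))) {x : ℤ → E}
    (hx : ∀ n : ℤ, x (n + 1) =
      stepSol Φ Ψ (n : ℝ) (x n) (fun u => b u (x n) + c n u) ((n : ℝ) + 1))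
    {MB : ℝ} (haM : IsBddMeasurable M a) (hbM : IsBddMeasurable MB b)
    (hf : IsBddMeasurable N f) (hR : ∀ n, ‖x n‖ ≤ R) (t : ℝ) :
    ‖glued b Φ Ψ c x t‖ ≤ (R + (MB * R + N)) * Real.exp M := by
  have := (isMild_glued h ha hb hc hfc hx ⌊t⌋).norm_le (haM.comp_const_add _)
    (isBddMeasurable_apply_add hbM hf (hR ⌊t⌋) _) (hR ⌊t⌋) (Int.fract t)
    ⟨Int.fract_nonneg t, (Int.fract_lt_one t).le⟩
  rwa [Int.floor_add_fract] at this

/-- Once the values at the integers have two-sided limits along a sequence of integer translations,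
so does the glued function. -/
theorem exists_tendsto_glued (h : IsFundamentalPair a Φ Ψ) (ha : Continuous a) (hb : Continuous b)
    (hc : ∀ n, Continuous (c n)) (hfc : ∀ n : ℤ, EqOn f (c n) (Ico (n : ℝ) (n + 1))) {x : ℤ → E}
    (hx : ∀ n : ℤ, x (n + 1) =
      stepSol Φ Ψ (n : ℝ) (x n) (fun u => b u (x n) + c n u) ((n : ℝ) + 1))
    {MB : ℝ} (haM : IsBddMeasurable M a) (hbM : IsBddMeasurable MB b)
    (hf : IsBddMeasurable N f) (hR : ∀ n, ‖x n‖ ≤ R)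
    {a' b' : ℤ → ℝ → E →L[ℝ] E} {f' : ℤ → ℝ → E} {x' : ℤ → E}
    (hal : ShiftLimit s (fun (m : ℤ) (τ : ℝ) => a (m + τ)) a')
    (hbl : ShiftLimit s (fun (m : ℤ) (τ : ℝ) => b (m + τ)) b')
    (hfl : ShiftLimit s (fun (m : ℤ) (τ : ℝ) => f (m + τ)) f') (hxl : ShiftLimit s x x') :
    ∃ y' : ℝ → E,
      (∀ t : ℝ, Tendsto (fun n => glued b Φ Ψ c x (t + (s n : ℝ))) atTop (𝓝 (y' t))) ∧
      (∀ t : ℝ, Tendsto (fun n => y' (t - (s n : ℝ))) atTop (𝓝 (glued b Φ Ψ c x t))) := by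
  have hgl : ShiftLimit s (fun (m : ℤ) (τ : ℝ) => b (m + τ) (x m) + f (m + τ))
      (fun m τ => b' m τ (x' m) + f' m τ) :=
    ShiftLimit.pi fun τ => ((hbl.apply τ).map₂ hxl isBoundedBilinearMap_apply.continuous).map₂
      (hfl.apply τ) continuous_add
  obtain ⟨z', hz'⟩ := IsMild.exists_shiftLimit (fun m => haM.comp_const_add (m : ℝ))
    (fun m => isBddMeasurable_apply_add hbM hf (hR m) (m : ℝ))
    (isMild_glued h ha hb hc hfc hx) hal hgl hxl
  refine ⟨fun t => z' ⌊t⌋ (Int.fract t), fun t => ?_, fun t => ?_⟩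
  · refine ((hz' (Int.fract t) ⟨Int.fract_nonneg t, (Int.fract_lt_one t).le⟩).1 ⌊t⌋).congr
      fun n => ?_
    push_cast
    rw [add_right_comm, Int.floor_add_fract]
  · have := (hz' (Int.fract t) ⟨Int.fract_nonneg t, (Int.fract_lt_one t).le⟩).2 ⌊t⌋
    simp only [Int.floor_add_fract] at this
    simpa only [Int.floor_sub_intCast, Int.fract_sub_intCast] using this

end BoundedSolution

/-- Existence: glue the solutions over unit intervals whose values at the integers are given by the
Green function. Along an integer sequence, a common subsequence provides two-sided limits of `A`,
`B`, `f` and the Green function, and these propagate to the forcing of the difference equation, to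
the values at the integers, and finally to the solution. -/
theorem exists_isCompactAlmostAutomorphic_isSolution {p : ℕ}
    {A B : ℝ → Matrix (Fin p) (Fin p) ℂ} {f : ℝ → Fin p → ℂ}
    (hA : IsAlmostAutomorphic A) (hB : IsAlmostAutomorphic B)
    (hf : IsZAlmostAutomorphic f) {Mf : ℝ} (hMf : ∀ t : ℝ, ‖f t‖ ≤ Mf)
    {Φ : ℝ → Matrix (Fin p) (Fin p) ℂ} (hΦ : IsFundamentalMatrix A Φ)
    {α K : ℝ} {P : Matrix (Fin p) (Fin p) ℂ} {Y : ℤ → Matrix (Fin p) (Fin p) ℂ} (hα : 0 < α)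
    (hY : IsDiscreteFundamentalMatrix (coeffC B Φ) Y)
    (hG : ∀ n m : ℤ, ‖green Y P n m‖ ≤ K * Real.exp (-α * |(n : ℝ) - (m : ℝ)|))
    (hGaa : IsBiAlmostAutomorphic (green Y P)) :
    ∃ y, IsCompactAlmostAutomorphic y ∧ IsSolution A B f y := by
  obtain ⟨MA, hMA⟩ := hA.exists_norm_le
  obtain ⟨MB, hMB⟩ := hB.exists_norm_le
  have hpair := hΦ.isFundamentalPair
  have ha : Continuous fun t => matOp p (A t) := (matOp p).continuous.comp hA.1
  have hb : Continuous fun t => matOp p (B t) := (matOp p).continuous.comp hB.1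
  have haM : IsBddMeasurable MA fun t => matOp p (A t) :=
    ⟨ha.stronglyMeasurable, fun t => (LinearIsometry.norm_map _ _).trans_le (hMA t)⟩
  have hbM : IsBddMeasurable MB fun t => matOp p (B t) :=
    ⟨hb.stronglyMeasurable, fun t => (LinearIsometry.norm_map _ _).trans_le (hMB t)⟩
  have hfM : IsBddMeasurable Mf f := ⟨hf.1.measurable.stronglyMeasurable, hMf⟩
  choose c hc hfc using hf.1.exists_continuous
  set Φo : ℝ → (Fin p → ℂ) →L[ℝ] (Fin p → ℂ) := fun t => matOp p (Φ t) with hΦo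
  set Ψo : ℝ → (Fin p → ℂ) →L[ℝ] (Fin p → ℂ) := fun t => matOp p (Φ t)⁻¹ with hΨo
  set G : ℤ → ℤ → (Fin p → ℂ) →L[ℝ] (Fin p → ℂ) := fun n m => matOp p (green Y P n m) with hGdef
  have hGo : ∀ n m : ℤ, ‖G n m‖ ≤ K * Real.exp (-α * |(n : ℝ) - m|) := fun n m =>
    (LinearIsometry.norm_map _ _).trans_le (hG n m)
  have hh := norm_forcing_le hpair ha haM hfM hc hfc
  set x := greenSum G (forcing Φo Ψo c) with hxdef
  have hR := norm_greenSum_le hα hGo hh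
  have hx : ∀ n : ℤ, x (n + 1) = stepSol Φo Ψo (n : ℝ) (x n)
      (fun u => matOp p (B u) (x n) + c n u) ((n : ℝ) + 1) := by
    intro n
    rw [hxdef, greenSum_succ (C := fun n => matOp p (coeffC B Φ n)) hα hGo hh fun n m => ?_,
      ← hxdef, matOp_apply, coeffC_mulVec hΦ hb, forcing,
      ← stepSol_add hpair (hb.clm_apply continuous_const) (hc n), add_zero]
    rw [hGdef]
    simp only [green_succ hY, map_add, matOp_mul]
    split_ifs
    · rw [matOp_one]
    · rw [map_zero]
  have hsol : IsSolution A B f (glued (fun t => matOp p (B t)) Φo Ψo c x) := by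
    refine ⟨continuous_glued hpair hb hc hx, fun n t ht => ?_, fun n => ?_⟩
    · rw [linearRHS_eq, Int.floor_eq_iff.2 ⟨ht.1.le, ht.2⟩, hfc n ⟨ht.1.le, ht.2⟩]
      exact hasDerivAt_glued hpair hb hc hx ht
    · rw [linearRHS_eq, Int.floor_intCast, hfc n ⟨le_rfl, lt_add_one _⟩]
      exact hasDerivWithinAt_glued hpair hb hc hx n
  obtain ⟨L, hL⟩ := hsol.exists_lipschitzWith hMA hMB hMf
    (norm_glued_le hpair ha hb hc hfc hx haM hbM hfM hR)
  refine ⟨_, isCompactAlmostAutomorphic_of_lipschitzWith hL fun s => ?_, hsol⟩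
  obtain ⟨φ₁, hφ₁, A', hA'⟩ := hA.exists_shiftLimit s
  obtain ⟨φ₂, hφ₂, B', hB'⟩ := hB.exists_shiftLimit (s ∘ φ₁)
  obtain ⟨φ₃, hφ₃, f', hf'⟩ := hf.exists_shiftLimit ((s ∘ φ₁) ∘ φ₂)
  obtain ⟨φ₄, hφ₄, G', hG'⟩ := hGaa.exists_shiftLimit (((s ∘ φ₁) ∘ φ₂) ∘ φ₃)
  have hal := ShiftLimit.pi fun τ =>
    ((((hA'.subseq hφ₂).subseq hφ₃).subseq hφ₄).apply τ).map (matOp p).continuous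
  have hbl := ShiftLimit.pi fun τ =>
    (((hB'.subseq hφ₃).subseq hφ₄).apply τ).map (matOp p).continuous
  have hfl := hf'.subseq hφ₄
  obtain ⟨h', hh'⟩ := exists_shiftLimit_forcing hpair ha haM hfM hc hfc hal hfl
  have hxl := ShiftLimit.greenSum (G' := fun n m => matOp p (G' n m)) hα hGo hh
    (fun j => (hG' j).map (matOp p).continuous) hh'
  exact ⟨((φ₁ ∘ φ₂) ∘ φ₃) ∘ φ₄, ((hφ₁.comp hφ₂).comp hφ₃).comp hφ₄,
    exists_tendsto_glued hpair ha hb hc hfc hx haM hbM hfM hR hal hbl hfl hxl⟩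

end DEPCA

theorem mainTheorem11 {p : ℕ}
    (A B : ℝ → Matrix (Fin p) (Fin p) ℂ) (f : ℝ → Fin p → ℂ)
    (hA : DEPCA.IsAlmostAutomorphic A) (hB : DEPCA.IsAlmostAutomorphic B)
    (hf : DEPCA.IsZAlmostAutomorphic f) (hf_bdd : ∃ M : ℝ, ∀ t : ℝ, ‖f t‖ ≤ M)
    (Φ : ℝ → Matrix (Fin p) (Fin p) ℂ) (hΦ : DEPCA.IsFundamentalMatrix A Φ)
    (α K : ℝ) (P : Matrix (Fin p) (Fin p) ℂ)
    (hC : DEPCA.HasBiAAExpDichotomy (DEPCA.coeffC B Φ) α K P) :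
    ∃! y : ℝ → Fin p → ℂ,
      DEPCA.IsCompactAlmostAutomorphic y ∧ DEPCA.IsSolution A B f y := by
  obtain ⟨hα, -, -, Y, hY, hG, hGaa⟩ := hC
  obtain ⟨Mf, hMf⟩ := hf_bdd
  obtain ⟨MA, hMA⟩ := hA.exists_norm_le
  refine existsUnique_of_exists_of_unique
    (DEPCA.exists_isCompactAlmostAutomorphic_isSolution hA hB hf hMf hΦ hα hY hG hGaa) ?_
  rintro y₁ y₂ ⟨h₁, hs₁⟩ ⟨h₂, hs₂⟩
  obtain ⟨R₁, hR₁⟩ := h₁.exists_norm_le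
  obtain ⟨R₂, hR₂⟩ := h₂.exists_norm_le
  exact hs₁.eq_of_bounded hMA ((DEPCA.matOp p).continuous.comp hB.1) hΦ hα hY hG hs₂ hR₁ hR₂
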